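/- Let $1\to H\to\Gamma\xrightarrow{p} B\to 1$ be an exact sequence of groups, where $B$ is a free group of finite rank or a surface group $\Pi_g=\langle a_1,\dots,a_g,b_1,\dots,b_g\mid [a_1,b_1]\cdots[a_g,b_g]=1\rangle$ with $g\ge 2$. All cohomology is group cohomology, $\mathbb Z$ has the trivial action, and $B$ acts on $H^1(H,\mathbb Z)=\mathrm{Hom}(H,\mathbb Z)$ through conjugation by lifts to $\Gamma$: $(p(\gamma)x)(h)=x(\gamma^{-1}h\gamma)$. Assume that the inflation map $p^*:H^2(B,\mathbb Z)\to H^2(\Gamma,\mathbb Z)$ is injective. Then: 1. $p^*:H^1(B,\mathbb Z)\to H^1(\Gamma,\mathbb Z)$ is injective, and restriction to $H$ induces an isomorphism $H^1(\Gamma,\mathbb Z)/p^*H^1(B,\mathbb Z)\cong H^1(H,\mathbb Z)^B$. 2. Let $F=\ker\big(H^2(\Gamma,\mathbb Z)\to H^2(H,\mathbb Z)\big)$. For $\alpha\in H^1(B,\mathbb Z)$ and $x\in H^1(\Gamma,\mathbb Z)$ one has $p^*\alpha\cup x\in F$, and there is an exact sequence $$0\to H^2(B,\mathbb Z)\xrightarrow{\,p^*\,}F\xrightarrow{\,\pi\,}H^1(B,H^1(H,\mathbb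 Z))\to 0$$ with $\pi(p^*\alpha\cup x)=\alpha\cup x|_H$. Here $\pi$ is the edge homomorphism of the Lyndon–Hochschild–Serre spectral sequence: each class in $F$ is represented by a cocycle $z:\Gamma\times\Gamma\to\mathbb Z$ with $z(h,\gamma)=0$ for all $h\in H$, $\gamma\in\Gamma$, such that $u(p(\gamma))(h)=z(\gamma,\gamma^{-1}h\gamma)$ defines a $1$-cocycle $u:B\to H^1(H,\mathbb Z)$ whose class is the image of the given class under $\pi$. 3. Call a subgroup of $H^1(G,\mathbb Z)$ isotropic if $x\cup y=0$ in $H^2(G,\mathbb Z)$ for all its elements $x,y$, and maximal isotropic if it is maximal for inclusion among the isotropic subgroups. Let $V$ be a maximal isotropic subgroup of $H^1(B,\mathbb Z)$. If $p^*V$ is maximal isotropic in $H^1(\Gamma,\mathbb Z)$, then the cup product $$H^1(B,\mathbb Z)\times H^1(H,\mathbb Z)^B\to H^1(B,H^1(H,\mathbb Z))$$ is nondegenerate in the second factor: the only $w\in H^1(H,\mathbb Z)^B$ with $\alpha\cup w=0$ for all $\alpha\in H^1(B,\mathbb Z)$ is $w=0$. If $B$ is free, the converse implication holds as well. -/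

import Mathlib

namespace GroupExtCup

noncomputable section

open groupCohomology

/-- The relator `[a₁, b₁] ⋯ [a_g, b_g]`, where `[a, b] = a b a⁻¹ b⁻¹`, in the free group on
`a₁, …, a_g, b₁, …, b_g`; `Sum.inl i` indexes `aᵢ` and `Sum.inr i` indexes `bᵢ`. -/
def surfaceRelator (g : ℕ) : FreeGroup (Fin g ⊕ Fin g) :=
  (List.ofFn fun i : Fin g =>
    FreeGroup.of (Sum.inl i : Fin g ⊕ Fin g) * FreeGroup.of (Sum.inr i) *
      (FreeGroup.of (Sum.inl i))⁻¹ * (FreeGroup.of (Sum.inr i))⁻¹).prod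

/-- The surface group `Π_g = ⟨a₁, …, a_g, b₁, …, b_g | [a₁, b₁] ⋯ [a_g, b_g] = 1⟩`. -/
abbrev SurfaceGroup (g : ℕ) : Type :=
  PresentedGroup ({surfaceRelator g} : Set (FreeGroup (Fin g ⊕ Fin g)))

/-- `B` is a free group of finite rank (rank `0` allowed). -/
def IsFreeOfFiniteRank (B : Type) [Group B] : Prop :=
  ∃ n : ℕ, Nonempty (B ≃* FreeGroup (Fin n))

/-- `B` is the fundamental group of a compact Riemann surface of some genus `g ≥ 2`. -/
def IsHyperbolicSurfaceGroup (B : Type) [Group B] : Prop :=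
  ∃ g : ℕ, 2 ≤ g ∧ Nonempty (B ≃* SurfaceGroup g)

/-- The integers with trivial `G`-action. -/
abbrev trivZ (G : Type) [Group G] : Rep.{0} ℤ G := Rep.trivial ℤ G ℤ

/-- The map `Hⁿ(K, ℤ) → Hⁿ(G, ℤ)` induced by a group homomorphism `f : G → K`, as a morphism of
`ℤ`-modules. -/
def pullbackHom {G K : Type} [Group G] [Group K] (f : G →* K) (n : ℕ) :
    groupCohomology (trivZ K) n ⟶ groupCohomology (trivZ G) n :=
  groupCohomology.map (A := trivZ K) (B := trivZ G) f
    (Rep.ofHom ⟨LinearMap.id, fun _ => rfl⟩) n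

/-- The map `Hⁿ(K, ℤ) → Hⁿ(G, ℤ)` induced by a group homomorphism `f : G → K`. -/
def pullback {G K : Type} [Group G] [Group K] (f : G →* K) (n : ℕ) :
    groupCohomology (trivZ K) n →+ groupCohomology (trivZ G) n :=
  (pullbackHom f n).hom.toAddMonoidHom

/-- The `G`-invariant elements of a `G`-module. -/
def invariantSubgroup {k G : Type} [CommRing k] [Group G] (M : Rep.{0} k G) : AddSubgroup M.V :=
  M.ρ.invariants.toAddSubgroup

/-- The homomorphism `G → ℤ` given by a class in `H¹(G, ℤ)`. -/
def evalH1 {G : Type} [Group G] : H1 (trivZ G) →+ (Additive G →+ ℤ) :=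
  (H1IsoOfIsTrivial (trivZ G)).hom.hom.toAddMonoidHom

theorem evalH1_H1π {G : Type} [Group G] (f : cocycles₁ (trivZ G)) (g : G) :
    evalH1 (H1π _ f) (Additive.ofMul g) = f g :=
  H1IsoOfIsTrivial_H1π_apply_apply f (Additive.ofMul g)

theorem evalH1_injective {G : Type} [Group G] :
    Function.Injective (evalH1 (G := G)) :=
  (H1IsoOfIsTrivial (trivZ G)).toLinearEquiv.injective

theorem evalH1_pullback {G K : Type} [Group G] [Group K] (f : G →* K)
    (x : H1 (trivZ K)) (g : G) :
    evalH1 (pullback f 1 x) (Additive.ofMul g) = evalH1 x (Additive.ofMul (f g)) := by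
  induction x using H1_induction_on with
  | h x =>
    have h := H1π_comp_map_apply (A := trivZ K) (B := trivZ G) f
      (Rep.ofHom ⟨LinearMap.id, fun _ => rfl⟩) x
    rw [evalH1_H1π]
    change evalH1 ((groupCohomology.map (A := trivZ K) (B := trivZ G) f
      (Rep.ofHom ⟨LinearMap.id, fun _ => rfl⟩) 1) (H1π (trivZ K) x)) _ = _
    rw [h]
    exact evalH1_H1π _ _

/-- The cup product `H¹(G, ℤ) × H¹(G, ℤ) → H²(G, ℤ)`, sending the classes of `x, y : G → ℤ` to the
class of the `2`-cocycle `(g, h) ↦ x(g) y(h)`. -/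
def cup {G : Type} [Group G] : H1 (trivZ G) →+ H1 (trivZ G) →+ H2 (trivZ G) :=
  AddMonoidHom.mk'
    (fun x => AddMonoidHom.mk'
      (fun y => H2π (trivZ G)
        ⟨fun p => evalH1 x (Additive.ofMul p.1) * evalH1 y (Additive.ofMul p.2), by
          rw [mem_cocycles₂_iff]
          intro g h j
          simp only [ofMul_mul, map_add]
          change _ = evalH1 x (Additive.ofMul h) * evalH1 y (Additive.ofMul j) + _
          exact (by intros; ring : ∀ a b c d : ℤ, (a + b) * c + a * d = b * c + a * (d + c))
            _ _ _ _⟩)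
      (fun y y' => by
        rw [← map_add]; congr 1; ext p
        change _ * evalH1 (y + y') _ = _ * evalH1 y _ + _ * evalH1 y' _
        simp [mul_add]))
    (fun x x' => by
      ext y
      change H2π (trivZ G) _ = H2π (trivZ G) _ + H2π (trivZ G) _
      rw [← map_add]; congr 1; ext p
      change evalH1 (x + x') _ * _ = evalH1 x _ * _ + evalH1 x' _ * _
      simp [add_mul])

/-- The cup product `H¹(G, ℤ) × M^G → H¹(G, M)`, sending the class of `x : G → ℤ` and the invariant
element `m` to the class of the `1`-cocycle `g ↦ x(g) m`. -/
def cupInv {G : Type} [Group G] (M : Rep.{0} ℤ G) :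
    H1 (trivZ G) →+ invariantSubgroup M →+ H1 M :=
  AddMonoidHom.mk'
    (fun x => AddMonoidHom.mk'
      (fun m => H1π M
        ⟨fun g => evalH1 x (Additive.ofMul g) • (m : M.V), by
          rw [mem_cocycles₁_iff]
          intro g h
          have hm : M.ρ g (m : M.V) = m := m.2 g
          simp only [ofMul_mul, map_add, map_zsmul, hm, add_smul]
          exact add_comm _ _⟩)
      (fun m m' => by
        rw [← map_add]; congr 1; ext p
        exact smul_add (evalH1 x (Additive.ofMul p)) (m : M.V) (m' : M.V)))
    (fun x x' => by
      ext m
      change H1π M _ = H1π M _ + H1π M _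
      rw [← map_add]; congr 1; ext p
      change evalH1 (x + x') _ • (m : M.V) = evalH1 x _ • (m : M.V) + evalH1 x' _ • (m : M.V)
      rw [map_add, AddMonoidHom.add_apply, add_smul])

/-- A subgroup of `H¹(G, ℤ)` is isotropic if the cup product of any two of its elements
vanishes in `H²(G, ℤ)`. -/
def IsIsotropic {G : Type} [Group G] (V : AddSubgroup (H1 (trivZ G))) : Prop :=
  ∀ x ∈ V, ∀ y ∈ V, cup x y = 0

/-- Maximal (for inclusion) among the isotropic subgroups. -/
def IsMaximalIsotropic {G : Type} [Group G] (V : AddSubgroup (H1 (trivZ G))) : Prop :=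
  Maximal IsIsotropic V

section Extension

variable {H Γ B : Type} [Group H] [Group Γ] [Group B] (S : GroupExtension H Γ B)

/-- The action of `Γ` on `H¹(H, ℤ)` induced by conjugation: `(γ x)(h) = x(γ⁻¹ h γ)`. -/
def conjRep : Representation ℤ Γ (H1 (trivZ H)) where
  toFun γ := (pullbackHom (S.conjAct γ⁻¹).toMonoidHom 1).hom
  map_one' := by
    refine LinearMap.ext fun x => evalH1_injective (AddMonoidHom.ext fun h => ?_)
    refine (evalH1_pullback _ x h.toMul).trans ?_
    simp
  map_mul' γ δ := by
    refine LinearMap.ext fun x => evalH1_injective (AddMonoidHom.ext fun h => ?_)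
    refine (evalH1_pullback _ x h.toMul).trans ?_
    refine Eq.trans ?_ (evalH1_pullback _ (pullback _ 1 x) h.toMul).symm
    rw [evalH1_pullback]
    simp

theorem conjRep_inl (k : H) : conjRep S (S.inl k) = 1 := by
  refine LinearMap.ext fun x => evalH1_injective (AddMonoidHom.ext fun h => ?_)
  refine (evalH1_pullback _ x h.toMul).trans ?_
  have : (S.conjAct (S.inl k)⁻¹).toMonoidHom h.toMul = k⁻¹ * h.toMul * k := by
    apply S.inl_injective
    change S.inl (S.conjAct (S.inl k)⁻¹ h.toMul) = _
    rw [S.inl_conjAct_comm]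
    simp
  rw [this]
  simp

theorem conjRep_eq {γ δ : Γ} (h : S.rightHom γ = S.rightHom δ) : conjRep S γ = conjRep S δ := by
  have hk : γ⁻¹ * δ ∈ S.inl.range := by
    rw [S.range_inl_eq_ker_rightHom, MonoidHom.mem_ker]
    simp [h]
  obtain ⟨k, hk⟩ := hk
  have hd : δ = γ * S.inl k := by rw [hk]; group
  rw [hd, map_mul, conjRep_inl, mul_one]

/-- The action of `B` on `H¹(H, ℤ)` induced by conjugation: an element of `B` acts as any of its
lifts to `Γ` (see `outerRep_apply`). -/
def outerRep : Representation ℤ B (H1 (trivZ H)) where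
  toFun b := conjRep S (Function.surjInv S.rightHom_surjective b)
  map_one' := by
    rw [← map_one (conjRep S)]
    exact conjRep_eq S ((Function.surjInv_eq S.rightHom_surjective 1).trans (map_one _).symm)
  map_mul' b c := by
    rw [← map_mul]
    exact conjRep_eq S (by simp only [map_mul, Function.surjInv_eq])

theorem outerRep_apply (γ : Γ) : outerRep S (S.rightHom γ) = conjRep S γ :=
  conjRep_eq S (Function.surjInv_eq _ _)

/-- The `B`-module `H¹(H, ℤ)`. -/
abbrev monodromyRep : Rep.{0} ℤ B := Rep.of (outerRep S)

/-- The group `H¹(H, ℤ)^B` of `B`-invariants. -/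
abbrev invH1 : AddSubgroup (H1 (trivZ H)) := invariantSubgroup (monodromyRep S)

/-- The inflation map `Hⁿ(B, ℤ) → Hⁿ(Γ, ℤ)`. -/
abbrev infl (n : ℕ) : groupCohomology (trivZ B) n →+ groupCohomology (trivZ Γ) n :=
  pullback S.rightHom n

/-- The restriction map `Hⁿ(Γ, ℤ) → Hⁿ(H, ℤ)`. -/
abbrev restr (n : ℕ) : groupCohomology (trivZ Γ) n →+ groupCohomology (trivZ H) n :=
  pullback S.inl n

/-- The subgroup `F = ker (H²(Γ, ℤ) → H²(H, ℤ))`, the first step of the Lyndon–Hochschild–Serre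
filtration of `H²(Γ, ℤ)`. -/
abbrev filtH2 : AddSubgroup (H2 (trivZ Γ)) := (restr S 2).ker

/-- The value `u(b)(h)` of a `1`-cochain `u` of `B` with values in `H¹(H, ℤ) = Hom(H, ℤ)`. -/
def evalCocycle (u : cocycles₁ (monodromyRep S)) (b : B) (h : H) : ℤ :=
  evalH1 (G := H) (u b : H1 (trivZ H)) (Additive.ofMul h)

/-- A homomorphism `F → H¹(B, H¹(H, ℤ))` is the edge map of the Lyndon–Hochschild–Serre spectral
sequence: each class in `F` has a representing cocycle `z` with `z(h, γ) = 0` for `h ∈ H`, and it is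
mapped to the class of the cocycle `u : B → H¹(H, ℤ)` given by `u(γ)(h) = z(γ, γ⁻¹ h γ)`. -/
def IsEdgeMap (π : filtH2 S →+ H1 (monodromyRep S)) : Prop :=
  ∀ c : filtH2 S, ∃ (z : cocycles₂ (trivZ Γ)) (u : cocycles₁ (monodromyRep S)),
    H2π (trivZ Γ) z = (c : H2 (trivZ Γ)) ∧
    (∀ (h : H) (γ : Γ), z (S.inl h, γ) = 0) ∧
    (∀ (γ : Γ) (h : H), evalCocycle S u (S.rightHom γ) h = z (γ, γ⁻¹ * S.inl h * γ)) ∧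
    π c = H1π (monodromyRep S) u

/-- The cup product `H¹(B, ℤ) × H¹(H, ℤ)^B → H¹(B, H¹(H, ℤ))` is nondegenerate in the
second factor. -/
def NondegenerateSecond : Prop :=
  ∀ w : invH1 S, (∀ α : H1 (trivZ B), cupInv (monodromyRep S) α w = 0) → w = 0

end Extension

end

end GroupExtCup

open GroupExtCup groupCohomology

/-!
# Cup products in extensions of free groups and surface groups

The low-degree part of the Lyndon–Hochschild–Serre spectral sequence is worked out with explicit
cocycles. The transgression of an invariant homomorphism `w : H → ℤ` is the coboundary of an
extension of `w` to an `H`-equivariant cochain of `Γ`; it dies in `H²(Γ, ℤ)`, so if inflation is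
injective then `w` extends to `Γ` (`exists_restr_one_eq`). A class of `H²(Γ, ℤ)` that vanishes on
`H` is represented by a cocycle `z` with `z(h, γ) = 0` (`edgeClass_surjective`). Such a `z` depends
only on the class of its first argument modulo `H`, is additive on `H` in the second, and gives the
cocycle `u(γ)(h) = z(γ, γ⁻¹ h γ)` of `B`. The class of `u` depends only on that of `z`, which defines
the edge map, and it is trivial exactly when `z` can be altered by a coboundary so as to descend
to `B`.

Surjectivity of the edge map amounts to the vanishing of a differential with values in `H³(B, ℤ)`.
A cocycle `u` makes `H × ℤ → Γ` a crossed module with cokernel `B`, and if this crossed module is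
split by a group `E` containing `H × ℤ`, then `E` is a central extension of `Γ` by `ℤ` whose cocycle
maps to `u` (`edgeHom_surjective`). For `B` free a semidirect product does it. A surface group is an
HNN extension of a free group `F` with associated subgroups infinite cyclic, so an HNN extension
of `(H × ℤ) ⋊ F` does it (`splitsCrossedModules_of_hnn`); that the base group of an HNN extension
embeds is what replaces the computation of `H³`.

For the isotropy statement, let `w` be orthogonal to `H¹(B, ℤ)` and extend it to `x` on `Γ`. Then
`p^*α ∪ x` is inflated from a class `c(α)` of `B`, with `c` additive. Poincaré duality for `B`
(`CupRepresents`, trivial for free groups, where `H² = 0`) writes `c(α) = α ∪ β`; replacing `x` by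
`x - p^*β` makes it orthogonal to `p^*V`, so maximality puts it in `p^*V` and `w = 0`. Duality for
surface groups follows from an embedding `H²(B, ℤ) → ℤ`, evaluation at the relator
(`exists_relatorValue`), which takes cup products to the symplectic form (`relator_value_cup`).
-/

namespace GroupExtCup

noncomputable section

/-! ### Integer cochains and classes in degrees one and two -/

section Cochains
variable {G K : Type} [Group G] [Group K]

/-- The integer `2`-cocycles of `G`, as curried functions with values in `ℤ` itself. -/
def intCocycles₂ (G : Type) [Group G] : AddSubgroup (G → G → ℤ) where
  carrier := {z | ∀ g h j, z (g * h) j + z g h = z h j + z g (h * j)}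
  zero_mem' := fun _ _ _ => rfl
  add_mem' := fun {a b} ha hb g h j => by
    have h₁ := ha g h j
    have h₂ := hb g h j
    simp only [Pi.add_apply]
    linarith
  neg_mem' := fun {a} ha g h j => by
    have h₁ := ha g h j
    simp only [Pi.neg_apply]
    linarith

theorem intCocycles₂_apply (z : intCocycles₂ G) (g h j : G) :
    z.1 (g * h) j + z.1 g h = z.1 h j + z.1 g (h * j) := z.2 g h j

/-- An integer `2`-cocycle as an element of Mathlib's `cocycles₂`. -/
def toCocycles₂ : intCocycles₂ G →+ cocycles₂ (trivZ G) :=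
  AddMonoidHom.mk'
    (fun z => ⟨fun p => z.1 p.1 p.2, (mem_cocycles₂_iff _).2 fun g h j => z.2 g h j⟩)
    (fun _ _ => rfl)

/-- The class in `H²(G, ℤ)` of an integer `2`-cocycle. -/
def intClass₂ : intCocycles₂ G →+ H2 (trivZ G) :=
  (H2π (trivZ G)).hom.toAddMonoidHom.comp toCocycles₂

theorem intClass₂_apply (z : intCocycles₂ G) : intClass₂ z = H2π (trivZ G) (toCocycles₂ z) := rfl

theorem intClass₂_surjective : Function.Surjective (intClass₂ (G := G)) := fun c => by
  induction c using H2_induction_on with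
  | h z => exact ⟨⟨fun g h => z (g, h), fun g h j => (mem_cocycles₂_iff _).1 z.2 g h j⟩, rfl⟩

/-- The coboundary `(g, h) ↦ f(g) + f(h) - f(gh)` of an integer `1`-cochain. -/
def intCoboundary (f : G → ℤ) : intCocycles₂ G :=
  ⟨fun g h => f g + f h - f (g * h), fun g h j => by simp only [mul_assoc]; ring⟩

theorem intClass₂_eq_zero_iff (z : intCocycles₂ G) :
    intClass₂ z = 0 ↔ ∃ f : G → ℤ, ∀ g h, z.1 g h = f g + f h - f (g * h) := by
  rw [intClass₂_apply, H2π_eq_zero_iff]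
  constructor
  · rintro ⟨f, hf⟩
    refine ⟨f, fun g h => ?_⟩
    have h₁ : f h - f (g * h) + f g = z.1 g h := congrFun hf (g, h)
    rw [← h₁]
    exact (by intros; ring : ∀ a b c : ℤ, b - c + a = a + b - c) _ _ _
  · rintro ⟨f, hf⟩
    refine ⟨f, funext fun p => ?_⟩
    change f p.2 - f (p.1 * p.2) + f p.1 = z.1 p.1 p.2
    rw [hf]
    ring

theorem intClass₂_coboundary (f : G → ℤ) : intClass₂ (intCoboundary f) = 0 :=
  (intClass₂_eq_zero_iff _).2 ⟨f, fun _ _ => rfl⟩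

/-- Composition of an integer `2`-cocycle with a homomorphism. -/
def comapCocycle (f : G →* K) (z : intCocycles₂ K) : intCocycles₂ G :=
  ⟨fun g h => z.1 (f g) (f h), fun g h j => by simpa using z.2 (f g) (f h) (f j)⟩

theorem pullback_intClass₂ (f : G →* K) (z : intCocycles₂ K) :
    pullback f 2 (intClass₂ z) = intClass₂ (comapCocycle f z) :=
  H2π_comp_map_apply (A := trivZ K) (B := trivZ G) f
      (Rep.ofHom ⟨LinearMap.id, fun _ => rfl⟩) (toCocycles₂ z)

/-- The value at `g` of the homomorphism `G → ℤ` given by a class in `H¹(G, ℤ)`. -/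
def val₁ (x : H1 (trivZ G)) (g : G) : ℤ := evalH1 x (Additive.ofMul g)

@[simp] theorem val₁_mul (x : H1 (trivZ G)) (g h : G) : val₁ x (g * h) = val₁ x g + val₁ x h :=
  map_add (evalH1 x) (Additive.ofMul g) (Additive.ofMul h)

@[simp] theorem val₁_one (x : H1 (trivZ G)) : val₁ x 1 = 0 := map_zero (evalH1 x)

@[simp] theorem val₁_inv (x : H1 (trivZ G)) (g : G) : val₁ x g⁻¹ = -val₁ x g :=
  map_neg (evalH1 x) (Additive.ofMul g)

@[simp] theorem val₁_add (x y : H1 (trivZ G)) (g : G) : val₁ (x + y) g = val₁ x g + val₁ y g := by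
  simp [val₁]

@[simp] theorem val₁_sub (x y : H1 (trivZ G)) (g : G) : val₁ (x - y) g = val₁ x g - val₁ y g := by
  simp [val₁]

@[simp] theorem val₁_zsmul (n : ℤ) (x : H1 (trivZ G)) (g : G) : val₁ (n • x) g = n * val₁ x g := by
  simp [val₁]

@[simp] theorem val₁_zero (g : G) : val₁ (0 : H1 (trivZ G)) g = 0 := by
  simp [val₁]

theorem val₁_ext {x y : H1 (trivZ G)} (h : ∀ g, val₁ x g = val₁ y g) : x = y :=
  evalH1_injective (AddMonoidHom.ext fun g => h g.toMul)

theorem val₁_pullback (f : G →* K) (x : H1 (trivZ K)) (g : G) :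
    val₁ (pullback f 1 x) g = val₁ x (f g) := evalH1_pullback f x g

theorem exists_val₁_eq (f : G → ℤ) (hf : ∀ g h, f (g * h) = f g + f h) :
    ∃ x : H1 (trivZ G), ∀ g, val₁ x g = f g := by
  obtain ⟨x, hx⟩ := (H1IsoOfIsTrivial (trivZ G)).toLinearEquiv.surjective
    (AddMonoidHom.mk' (fun g : Additive G => f g.toMul) fun g h => hf g.toMul h.toMul)
  exact ⟨x, fun g => DFunLike.congr_fun hx (Additive.ofMul g)⟩

/-- The cocycle `(g, h) ↦ x(g) y(h)` representing the cup product. -/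
def cupCocycle (x y : H1 (trivZ G)) : intCocycles₂ G :=
  ⟨fun g h => val₁ x g * val₁ y h, fun g h j => by simp only [val₁_mul]; ring⟩

theorem cup_eq (x y : H1 (trivZ G)) : cup x y = intClass₂ (cupCocycle x y) := rfl

theorem cup_pullback (f : G →* K) (x y : H1 (trivZ K)) :
    cup (pullback f 1 x) (pullback f 1 y) = pullback f 2 (cup x y) := by
  rw [cup_eq, cup_eq, pullback_intClass₂]
  congr 1
  refine Subtype.ext (funext fun g => funext fun h => ?_)
  change val₁ _ g * val₁ _ h = val₁ x (f g) * val₁ y (f h)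
  rw [val₁_pullback, val₁_pullback]

theorem cup_self (x : H1 (trivZ G)) : cup x x = 0 := by
  rw [cup_eq, intClass₂_eq_zero_iff]
  -- `x ∪ x` is the coboundary of `-x(x-1)/2`
  refine ⟨fun g => -(val₁ x g * (val₁ x g - 1) / 2), fun g h => ?_⟩
  change val₁ x g * val₁ x h = _
  simp only [val₁_mul]
  obtain ⟨a, ha⟩ := (Int.even_mul_pred_self (val₁ x g)).two_dvd
  obtain ⟨b, hb⟩ := (Int.even_mul_pred_self (val₁ x h)).two_dvd
  obtain ⟨c, hc⟩ := (Int.even_mul_pred_self (val₁ x g + val₁ x h)).two_dvd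
  rw [ha, hb, hc]
  simp only [ne_eq, OfNat.ofNat_ne_zero, not_false_eq_true, Int.mul_ediv_cancel_left]
  linarith

theorem cup_comm_neg (x y : H1 (trivZ G)) : cup x y = -cup y x := by
  have h := cup_self (x + y)
  simp only [map_add, AddMonoidHom.add_apply, cup_self, zero_add, add_zero] at h
  exact eq_neg_of_add_eq_zero_right h

end Cochains

section Extension
variable {H Γ B : Type} [Group H] [Group Γ] [Group B] (S : GroupExtension H Γ B)

theorem inl_conj (γ : Γ) (h : H) : S.inl (S.conjAct γ⁻¹ h) = γ⁻¹ * S.inl h * γ := by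
  rw [S.inl_conjAct_comm]; simp

theorem exists_inl_of_rightHom_eq {γ δ : Γ} (h : S.rightHom γ = S.rightHom δ) :
    ∃ k : H, γ = S.inl k * δ := by
  have hk : γ * δ⁻¹ ∈ S.inl.range := by
    rw [S.range_inl_eq_ker_rightHom, MonoidHom.mem_ker]
    simp [h]
  obtain ⟨k, hk⟩ := hk
  exact ⟨k, by rw [hk]; group⟩

theorem val₁_outerRep (γ : Γ) (x : H1 (trivZ H)) (h : H) :
    val₁ (outerRep S (S.rightHom γ) x) h = val₁ x (S.conjAct γ⁻¹ h) := by
  rw [outerRep_apply]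
  exact val₁_pullback _ x h

theorem mem_invH1_iff (x : H1 (trivZ H)) :
    x ∈ invH1 S ↔ ∀ (γ : Γ) (h : H), val₁ x (S.conjAct γ⁻¹ h) = val₁ x h := by
  constructor
  · intro hx γ h
    rw [← val₁_outerRep]
    exact congrArg (fun y => val₁ y h) (hx (S.rightHom γ))
  · intro hx b
    obtain ⟨γ, rfl⟩ := S.rightHom_surjective b
    exact val₁_ext fun h => (val₁_outerRep S γ x h).trans (hx γ h)

theorem evalCocycle_ext {u v : cocycles₁ (monodromyRep S)}
    (h : ∀ γ k, evalCocycle S u (S.rightHom γ) k = evalCocycle S v (S.rightHom γ) k) : u = v := by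
  refine cocycles₁_ext fun b => ?_
  obtain ⟨γ, rfl⟩ := S.rightHom_surjective b
  exact val₁_ext fun k => h γ k

theorem evalCocycle_mul (u : cocycles₁ (monodromyRep S)) (γ δ : Γ) (h : H) :
    evalCocycle S u (S.rightHom (γ * δ)) h =
      evalCocycle S u (S.rightHom γ) h + evalCocycle S u (S.rightHom δ) (S.conjAct γ⁻¹ h) := by
  have h₁ := (mem_cocycles₁_iff (A := monodromyRep S) u).1 u.2 (S.rightHom γ) (S.rightHom δ)
  have h₂ := congrArg (fun y : H1 (trivZ H) => val₁ y h) h₁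
  rw [map_mul]
  refine h₂.trans ((val₁_add _ _ h).trans ?_)
  rw [add_comm]
  exact congrArg _ (val₁_outerRep S γ _ h)

theorem evalCocycle_hom (u : cocycles₁ (monodromyRep S)) (b : B) (h k : H) :
    evalCocycle S u b (h * k) = evalCocycle S u b h + evalCocycle S u b k :=
  val₁_mul _ h k

/-- A function `v : Γ × H → ℤ` with the right invariance properties comes from a `1`-cocycle of `B`
with values in `H¹(H, ℤ)`. -/
theorem exists_evalCocycle_eq (v : Γ → H → ℤ) (hadd : ∀ γ h k, v γ (h * k) = v γ h + v γ k)
    (hinv : ∀ k γ h, v (S.inl k * γ) h = v γ h)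
    (hmul : ∀ γ δ h, v (γ * δ) h = v γ h + v δ (S.conjAct γ⁻¹ h)) :
    ∃ u : cocycles₁ (monodromyRep S), ∀ γ h, evalCocycle S u (S.rightHom γ) h = v γ h := by
  choose x hx using fun γ => exists_val₁_eq (v γ) (hadd γ)
  have hxB : ∀ {γ δ : Γ}, S.rightHom γ = S.rightHom δ → x γ = x δ := fun {γ δ} h => by
    obtain ⟨k, rfl⟩ := exists_inl_of_rightHom_eq S h
    exact val₁_ext fun j => by rw [hx, hx, hinv]
  let σ := Function.surjInv S.rightHom_surjective
  have hσ : ∀ b, S.rightHom (σ b) = b := Function.surjInv_eq S.rightHom_surjective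
  refine ⟨⟨fun b => x (σ b), (mem_cocycles₁_iff _).2 fun b c => ?_⟩, fun γ h => ?_⟩
  · have h₁ : x (σ (b * c)) = x (σ b * σ c) := hxB (by simp [hσ])
    rw [h₁]
    refine val₁_ext fun h => ?_
    refine Eq.trans ?_ (val₁_add (outerRep S b (x (σ c))) (x (σ b)) h).symm
    have h₂ := val₁_outerRep S (σ b) (x (σ c)) h
    rw [hσ] at h₂
    rw [h₂, hx, hx, hx, hmul, add_comm]
  · have h₁ : x (σ (S.rightHom γ)) = x γ := hxB (hσ _)
    change val₁ (x (σ (S.rightHom γ))) h = _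
    rw [h₁, hx]

theorem H1π_monodromyRep_eq_zero_iff (u : cocycles₁ (monodromyRep S)) :
    H1π (monodromyRep S) u = 0 ↔ ∃ x : H1 (trivZ H), ∀ γ h,
      evalCocycle S u (S.rightHom γ) h = val₁ x (S.conjAct γ⁻¹ h) - val₁ x h := by
  rw [H1π_eq_zero_iff]
  constructor
  · rintro ⟨x, hx⟩
    refine ⟨x, fun γ h => ?_⟩
    have h₁ : outerRep S (S.rightHom γ) x - x = u (S.rightHom γ) := congrFun hx (S.rightHom γ)
    change val₁ (u (S.rightHom γ)) h = _
    rw [← h₁]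
    refine (val₁_sub _ _ h).trans ?_
    rw [val₁_outerRep]
  · rintro ⟨x, hx⟩
    refine ⟨x, funext fun b => ?_⟩
    obtain ⟨γ, rfl⟩ := S.rightHom_surjective b
    refine val₁_ext fun h => Eq.trans ?_ (hx γ h).symm
    refine (val₁_sub (outerRep S (S.rightHom γ) x) x h).trans ?_
    rw [val₁_outerRep]

end Extension

/-! ### The seven-term exact sequence -/

section LHS
variable {H Γ B : Type} [Group H] [Group Γ] [Group B] (S : GroupExtension H Γ B)

/-- An `H`-equivariant retraction of `Γ` onto `H`, that is, a choice of coset representatives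
with `1` representing `H`. -/
theorem exists_retraction :
    ∃ κ : Γ → H, κ 1 = 1 ∧ ∀ h γ, κ (S.inl h * γ) = h * κ γ := by
  choose κ hκ using fun γ : Γ => exists_inl_of_rightHom_eq S
    (γ := γ) (δ := Function.surjInv S.rightHom_surjective (S.rightHom γ))
    (Function.surjInv_eq S.rightHom_surjective _).symm
  have h₁ : ∀ h γ, κ (S.inl h * γ) = h * κ γ := fun h γ => by
    apply S.inl_injective
    have h₂ := hκ (S.inl h * γ)
    rw [map_mul S.rightHom, S.rightHom_inl, one_mul] at h₂
    rw [map_mul, ← mul_left_inj, ← h₂, mul_assoc, ← hκ γ]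
  exact ⟨fun γ => κ γ * (κ 1)⁻¹, by simp, fun h γ => by simp [h₁, mul_assoc]⟩

/-- A cocycle of `Γ` depending only on the images of its arguments in `B` is inflated from `B`. -/
theorem exists_comapCocycle_eq (z : intCocycles₂ Γ)
    (hl : ∀ k γ δ, z.1 (S.inl k * γ) δ = z.1 γ δ) (hr : ∀ k γ δ, z.1 γ (S.inl k * δ) = z.1 γ δ) :
    ∃ c : intCocycles₂ B, comapCocycle S.rightHom c = z := by
  let σ := Function.surjInv S.rightHom_surjective
  have hσ : ∀ b, S.rightHom (σ b) = b := Function.surjInv_eq S.rightHom_surjective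
  have hz : ∀ {γ γ' δ δ' : Γ}, S.rightHom γ = S.rightHom γ' → S.rightHom δ = S.rightHom δ' →
      z.1 γ δ = z.1 γ' δ' := fun {γ γ' δ δ'} h h' => by
    obtain ⟨k, rfl⟩ := exists_inl_of_rightHom_eq S h
    obtain ⟨k', rfl⟩ := exists_inl_of_rightHom_eq S h'
    rw [hl, hr]
  refine ⟨⟨fun b c => z.1 (σ b) (σ c), fun b c d => ?_⟩, ?_⟩
  · have h₁ : z.1 (σ (b * c)) (σ d) = z.1 (σ b * σ c) (σ d) := hz (by simp [hσ]) rfl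
    have h₂ : z.1 (σ b) (σ (c * d)) = z.1 (σ b) (σ c * σ d) := hz rfl (by simp [hσ])
    dsimp only
    rw [h₁, h₂]
    exact z.2 _ _ _
  · exact Subtype.ext (funext fun γ => funext fun δ => hz (hσ _) (hσ _))

theorem infl_one_injective : Function.Injective (infl S 1) := fun x y hxy =>
  val₁_ext fun b => by
    obtain ⟨γ, rfl⟩ := S.rightHom_surjective b
    rw [← val₁_pullback, ← val₁_pullback, hxy]

theorem restr_infl_one (x : H1 (trivZ B)) : restr S 1 (infl S 1 x) = 0 :=
  val₁_ext fun h => by simp [val₁_pullback]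

theorem restr_one_mem_invH1 (x : H1 (trivZ Γ)) : restr S 1 x ∈ invH1 S := by
  rw [mem_invH1_iff]
  intro γ h
  rw [val₁_pullback, val₁_pullback, inl_conj]
  simp

theorem mem_range_infl_one_of_restr_eq_zero (x : H1 (trivZ Γ)) (hx : restr S 1 x = 0) :
    x ∈ (infl S 1).range := by
  have hxH : ∀ h, val₁ x (S.inl h) = 0 := fun h => by rw [← val₁_pullback, hx, val₁_zero]
  let σ := Function.surjInv S.rightHom_surjective
  have hσ : ∀ b, S.rightHom (σ b) = b := Function.surjInv_eq S.rightHom_surjective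
  have hxB : ∀ {γ δ : Γ}, S.rightHom γ = S.rightHom δ → val₁ x γ = val₁ x δ := fun {γ δ} h => by
    obtain ⟨k, rfl⟩ := exists_inl_of_rightHom_eq S h
    simp [hxH]
  obtain ⟨y, hy⟩ := exists_val₁_eq (fun b => val₁ x (σ b)) fun b c => by
    rw [← val₁_mul]
    exact hxB (by simp [hσ])
  refine ⟨y, val₁_ext fun γ => ?_⟩
  rw [val₁_pullback, hy]
  exact hxB (hσ _)

/-- The transgression `H¹(H, ℤ)^B → H²(B, ℤ)` takes values in the kernel of inflation. If the latter
vanishes, then every invariant class of `H` extends to `Γ`. -/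
theorem exists_restr_one_eq (hinj : Function.Injective (infl S 2)) (w : H1 (trivZ H))
    (hw : w ∈ invH1 S) : ∃ x : H1 (trivZ Γ), restr S 1 x = w := by
  rw [mem_invH1_iff] at hw
  obtain ⟨κ, hκ1, hκ⟩ := exists_retraction S
  have hf : ∀ k γ, val₁ w (κ (S.inl k * γ)) = val₁ w k + val₁ w (κ γ) := fun k γ => by
    rw [hκ, val₁_mul]
  obtain ⟨c, hc⟩ := exists_comapCocycle_eq S (intCoboundary fun γ => val₁ w (κ γ))
    (fun k γ δ => by
      change _ + _ - _ = _ + _ - _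
      dsimp only
      rw [mul_assoc, hf, hf]
      ring)
    (fun k γ δ => by
      change _ + _ - _ = _ + _ - _
      have h₁ : γ * (S.inl k * δ) = S.inl (S.conjAct γ⁻¹⁻¹ k) * (γ * δ) := by
        rw [inl_conj]; group
      dsimp only
      rw [h₁, hf, hf, hw]
      ring)
  have hc0 : intClass₂ c = 0 := by
    apply hinj
    rw [map_zero, pullback_intClass₂, hc, intClass₂_coboundary]
  obtain ⟨b, hb⟩ := (intClass₂_eq_zero_iff c).1 hc0
  obtain ⟨x, hx⟩ := exists_val₁_eq (fun γ => val₁ w (κ γ) - b (S.rightHom γ)) fun γ δ => by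
    have h₁ : c.1 (S.rightHom γ) (S.rightHom δ) =
        val₁ w (κ γ) + val₁ w (κ δ) - val₁ w (κ (γ * δ)) :=
      congrFun (congrFun (congrArg Subtype.val hc) γ) δ
    rw [hb] at h₁
    rw [map_mul]
    linarith
  refine ⟨x, val₁_ext fun h => ?_⟩
  have h₁ := hx 1
  rw [val₁_one, hκ1, val₁_one, map_one] at h₁
  have h₂ := hf h 1
  rw [mul_one, hκ1, val₁_one] at h₂
  rw [val₁_pullback, hx, S.rightHom_inl, h₂]
  linarith

theorem cup_infl_mem_filtH2 (α : H1 (trivZ B)) (x : H1 (trivZ Γ)) :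
    cup (infl S 1 α) x ∈ filtH2 S := by
  change restr S 2 _ = 0
  rw [← cup_pullback, restr_infl_one]
  simp

/-- The integer cocycles of `Γ` that vanish whenever their first argument lies in `H`. -/
def edgeCocycles : AddSubgroup (intCocycles₂ Γ) where
  carrier := {z | ∀ h γ, z.1 (S.inl h) γ = 0}
  zero_mem' := fun _ _ => rfl
  add_mem' := fun {a b} ha hb h γ => by
    change a.1 _ _ + b.1 _ _ = 0
    rw [ha, hb, add_zero]
  neg_mem' := fun {a} ha h γ => by
    change -a.1 _ _ = 0
    rw [ha, neg_zero]

variable {S}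

theorem edgeCocycles_inl_mul (z : edgeCocycles S) (k : H) (γ δ : Γ) :
    z.1.1 (S.inl k * γ) δ = z.1.1 γ δ := by
  have h := intCocycles₂_apply z.1 (S.inl k) γ δ
  rw [z.2, z.2] at h
  simpa using h

theorem edgeCocycles_apply_inl_mul (z : edgeCocycles S) (k : H) (γ δ : Γ) :
    z.1.1 γ (S.inl k * δ) = z.1.1 γ δ + z.1.1 γ (S.inl k) := by
  have h := intCocycles₂_apply z.1 γ (S.inl k) δ
  have h₁ : γ * S.inl k = S.inl (S.conjAct γ⁻¹⁻¹ k) * γ := by rw [inl_conj]; group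
  rw [z.2, h₁, edgeCocycles_inl_mul] at h
  linarith

theorem edgeCocycles_apply_inl_conj (z : edgeCocycles S) (γ : Γ) (k h : H) :
    z.1.1 γ (S.inl (k⁻¹ * h * k)) = z.1.1 γ (S.inl h) := by
  have hmul : ∀ a b : H, z.1.1 γ (S.inl (a * b)) = z.1.1 γ (S.inl a) + z.1.1 γ (S.inl b) :=
    fun a b => by rw [map_mul, edgeCocycles_apply_inl_mul, add_comm]
  have h₁ : k * (k⁻¹ * h * k) = h * k := by group
  have h₂ := hmul k (k⁻¹ * h * k)
  rw [h₁, hmul] at h₂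
  linarith

theorem exists_edgeHom (z : edgeCocycles S) : ∃ u : cocycles₁ (monodromyRep S),
    ∀ γ h, evalCocycle S u (S.rightHom γ) h = z.1.1 γ (γ⁻¹ * S.inl h * γ) := by
  simp_rw [← inl_conj]
  refine exists_evalCocycle_eq S (fun γ h => z.1.1 γ (S.inl (S.conjAct γ⁻¹ h)))
    (fun γ h k => ?_) (fun k γ h => ?_) (fun γ δ h => ?_)
  · rw [map_mul, map_mul S.inl, edgeCocycles_apply_inl_mul, add_comm]
  · have h₁ : S.inl (S.conjAct γ⁻¹ h) = S.inl ((S.conjAct γ⁻¹ k)⁻¹⁻¹ *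
        S.conjAct (S.inl k * γ)⁻¹ h * (S.conjAct γ⁻¹ k)⁻¹) := by
      rw [map_mul, map_mul, map_inv S.inl, map_inv S.inl, inl_conj, inl_conj, inl_conj]
      group
    rw [edgeCocycles_inl_mul, h₁, edgeCocycles_apply_inl_conj]
  · set m := S.conjAct (γ * δ)⁻¹ h with hm
    have hm' : S.conjAct δ⁻¹ (S.conjAct γ⁻¹ h) = m := by simp [hm]
    have h₁ : δ * S.inl m = S.inl (S.conjAct γ⁻¹ h) * δ := by
      rw [← hm', inl_conj]; group
    have h₂ := intCocycles₂_apply z.1 γ δ (S.inl m)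
    rw [h₁, edgeCocycles_apply_inl_mul] at h₂
    rw [hm']
    linarith

variable (S) in
/-- The homomorphism sending an edge cocycle `z` to the `1`-cocycle `u` of `B` with
`u(γ)(h) = z(γ, γ⁻¹ h γ)`. -/
def edgeHom : edgeCocycles S →+ cocycles₁ (monodromyRep S) :=
  AddMonoidHom.mk' (fun z => (exists_edgeHom z).choose) fun z z' => evalCocycle_ext S fun γ h => by
    refine Eq.trans ?_ (val₁_add _ _ h).symm
    refine Eq.trans ?_ (congrArg₂ (· + ·) ((exists_edgeHom z).choose_spec γ h)
      ((exists_edgeHom z').choose_spec γ h)).symm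
    exact (exists_edgeHom (z + z')).choose_spec γ h

theorem evalCocycle_edgeHom (z : edgeCocycles S) (γ : Γ) (h : H) :
    evalCocycle S (edgeHom S z) (S.rightHom γ) h = z.1.1 γ (γ⁻¹ * S.inl h * γ) :=
  (exists_edgeHom z).choose_spec γ h

theorem restr_edgeCocycle (z : edgeCocycles S) : intClass₂ z.1 ∈ filtH2 S := by
  change restr S 2 _ = 0
  rw [pullback_intClass₂, ← map_zero intClass₂]
  congr 1
  exact Subtype.ext (funext fun g => funext fun h => z.2 g _)

variable (S) in
/-- The class of an edge cocycle, as an element of `F`. -/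
def edgeClass : edgeCocycles S →+ filtH2 S :=
  AddMonoidHom.mk' (fun z => ⟨intClass₂ z.1, restr_edgeCocycle z⟩) fun z z' =>
    Subtype.ext (map_add intClass₂ z.1 z'.1)

theorem edgeClass_surjective : Function.Surjective (edgeClass S) := by
  rintro ⟨c, hc⟩
  obtain ⟨z, rfl⟩ := intClass₂_surjective c
  change restr S 2 _ = 0 at hc
  rw [pullback_intClass₂, intClass₂_eq_zero_iff] at hc
  obtain ⟨x, hx⟩ := hc
  replace hx : ∀ g h, z.1 (S.inl g) (S.inl h) = x g + x h - x (g * h) := hx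
  obtain ⟨κ, hκ1, hκ⟩ := exists_retraction S
  let g : Γ → ℤ := fun γ => z.1 (S.inl (κ γ)) ((S.inl (κ γ))⁻¹ * γ) - x (κ γ) - x 1
  -- the cocycle identity at `(h, κ γ, (κ γ)⁻¹ γ)`
  have hz : ∀ h γ, z.1 (S.inl h) γ = g (S.inl h * γ) - g γ + x h := fun h γ => by
    have h₁ := intCocycles₂_apply z (S.inl h) (S.inl (κ γ)) ((S.inl (κ γ))⁻¹ * γ)
    have h₂ : S.inl (κ (S.inl h * γ)) = S.inl h * S.inl (κ γ) := by rw [hκ, map_mul]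
    have h₃ : (S.inl h * S.inl (κ γ))⁻¹ * (S.inl h * γ) = (S.inl (κ γ))⁻¹ * γ := by group
    rw [mul_inv_cancel_left, hx] at h₁
    simp only [g]
    rw [h₂, h₃, hκ]
    linarith
  have hg : ∀ h, g (S.inl h) = -x h := fun h => by
    have h₁ : κ (S.inl h) = h := by simpa [hκ1] using hκ h 1
    have h₂ := hx h 1
    simp only [map_one, mul_one] at h₂
    simp only [g]
    rw [h₁, inv_mul_cancel, h₂]
    ring
  refine ⟨⟨z + intCoboundary g, fun h γ => ?_⟩, Subtype.ext ?_⟩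
  · change z.1 _ _ + (g _ + g _ - g _) = 0
    rw [hz, hg]
    ring
  · change intClass₂ (z + intCoboundary g) = intClass₂ z
    rw [map_add, intClass₂_coboundary, add_zero]

theorem H1π_edgeHom_eq_zero (z : edgeCocycles S) (hz : edgeClass S z = 0) :
    H1π (monodromyRep S) (edgeHom S z) = 0 := by
  obtain ⟨f, hf⟩ := (intClass₂_eq_zero_iff z.1).1 (congrArg Subtype.val hz)
  have hH : ∀ h γ, f (S.inl h * γ) = f (S.inl h) + f γ := fun h γ => by
    have := hf (S.inl h) γ
    rw [z.2] at this
    linarith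
  obtain ⟨x, hx⟩ := exists_val₁_eq (fun h => f (S.inl h)) fun g h => by rw [map_mul, hH]
  refine (H1π_monodromyRep_eq_zero_iff S _).2 ⟨x, fun γ h => ?_⟩
  rw [evalCocycle_edgeHom, hf, hx, hx, inl_conj]
  have h₁ : γ * (γ⁻¹ * S.inl h * γ) = S.inl h * γ := by group
  rw [h₁, hH]
  ring

variable (S) in
/-- The edge homomorphism `F → H¹(B, H¹(H, ℤ))`. -/
def edgeMap : filtH2 S →+ H1 (monodromyRep S) :=
  (edgeClass S).liftOfRightInverse _ (Function.rightInverse_surjInv edgeClass_surjective)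
    ⟨(H1π (monodromyRep S)).hom.toAddMonoidHom.comp (edgeHom S), fun z hz =>
      H1π_edgeHom_eq_zero z hz⟩

theorem edgeMap_edgeClass (z : edgeCocycles S) :
    edgeMap S (edgeClass S z) = H1π (monodromyRep S) (edgeHom S z) :=
  AddMonoidHom.liftOfRightInverse_comp_apply _ _ _ _ _

theorem isEdgeMap_edgeMap : IsEdgeMap S (edgeMap S) := fun c => by
  obtain ⟨z, rfl⟩ := edgeClass_surjective c
  exact ⟨toCocycles₂ z.1, edgeHom S z, rfl, z.2, evalCocycle_edgeHom z, edgeMap_edgeClass z⟩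

variable (S) in
/-- Inflation `H²(B, ℤ) → F`. -/
def inflH2 : H2 (trivZ B) →+ filtH2 S :=
  (infl S 2).codRestrict (filtH2 S) fun c => by
    obtain ⟨z, rfl⟩ := intClass₂_surjective c
    change restr S 2 _ = 0
    rw [pullback_intClass₂, pullback_intClass₂, intClass₂_eq_zero_iff]
    refine ⟨fun _ => z.1 1 1, fun g h => ?_⟩
    change z.1 (S.rightHom (S.inl g)) (S.rightHom (S.inl h)) = _
    rw [S.rightHom_inl, S.rightHom_inl]
    ring

theorem coe_inflH2 (c : H2 (trivZ B)) : (inflH2 S c : H2 (trivZ Γ)) = infl S 2 c := rfl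

theorem edgeMap_inflH2 (c : H2 (trivZ B)) : edgeMap S (inflH2 S c) = 0 := by
  obtain ⟨z, rfl⟩ := intClass₂_surjective c
  -- normalise `z` so that it vanishes when one of its arguments is `1`
  have hl : ∀ b, z.1 1 b = z.1 1 1 := fun b => by
    have := intCocycles₂_apply z 1 1 b
    simp only [one_mul] at this
    linarith
  have hr : ∀ b, z.1 b 1 = z.1 1 1 := fun b => by
    have := intCocycles₂_apply z b 1 1
    simp only [mul_one] at this
    linarith
  let e : edgeCocycles S := ⟨comapCocycle S.rightHom (z - intCoboundary fun _ => z.1 1 1),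
    fun h γ => by
      change z.1 (S.rightHom (S.inl h)) (S.rightHom γ) - (z.1 1 1 + z.1 1 1 - z.1 1 1) = 0
      rw [S.rightHom_inl, hl]
      ring⟩
  have he : inflH2 S (intClass₂ z) = edgeClass S e := by
    refine Subtype.ext ?_
    change infl S 2 (intClass₂ z) = intClass₂ (comapCocycle S.rightHom _)
    rw [← pullback_intClass₂, map_sub, intClass₂_coboundary, sub_zero]
  have hu : edgeHom S e = 0 := evalCocycle_ext S fun γ h => by
    rw [evalCocycle_edgeHom]
    refine Eq.trans ?_ (val₁_zero h).symm
    change z.1 (S.rightHom γ) (S.rightHom (γ⁻¹ * S.inl h * γ)) - (z.1 1 1 + z.1 1 1 - z.1 1 1) = 0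
    have h₁ : S.rightHom (γ⁻¹ * S.inl h * γ) = 1 := by simp
    rw [h₁, hr]
    ring
  rw [he, edgeMap_edgeClass, hu, map_zero]

theorem mem_range_inflH2_of_edgeMap_eq_zero (c : filtH2 S) (hc : edgeMap S c = 0) :
    c ∈ Set.range (inflH2 S) := by
  obtain ⟨z, rfl⟩ := edgeClass_surjective c
  rw [edgeMap_edgeClass, H1π_monodromyRep_eq_zero_iff] at hc
  obtain ⟨x, hx⟩ := hc
  simp only [evalCocycle_edgeHom] at hx
  obtain ⟨κ, hκ1, hκ⟩ := exists_retraction S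
  have hf : ∀ k γ, val₁ x (κ (S.inl k * γ)) = val₁ x k + val₁ x (κ γ) := fun k γ => by
    rw [hκ, val₁_mul]
  have hfH : ∀ k, val₁ x (κ (S.inl k)) = val₁ x k := fun k => by
    simpa [hκ1] using hf k 1
  let z' : edgeCocycles S := ⟨z.1 - intCoboundary fun γ => val₁ x (κ γ), fun h γ => by
    change z.1.1 _ _ - (_ + _ - _) = 0
    dsimp only
    rw [z.2, hf, hfH]
    ring⟩
  have hz' : ∀ γ k, z'.1.1 γ (S.inl k) = 0 := fun γ k => by
    have h₁ : S.inl k = γ⁻¹ * S.inl (S.conjAct γ⁻¹⁻¹ k) * γ := by rw [inl_conj]; group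
    have h₂ := hx γ (S.conjAct γ⁻¹⁻¹ k)
    rw [← h₁] at h₂
    have h₃ : γ * S.inl k = S.inl (S.conjAct γ⁻¹⁻¹ k) * γ := by rw [inl_conj]; group
    have h₄ : S.conjAct γ⁻¹ (S.conjAct γ⁻¹⁻¹ k) = k := by simp
    change z.1.1 _ _ - (val₁ x (κ γ) + val₁ x (κ (S.inl k)) - val₁ x (κ (γ * S.inl k))) = 0
    rw [h₂, h₃, hf, hfH, h₄]
    ring
  obtain ⟨c, hc⟩ := exists_comapCocycle_eq S z'.1 (edgeCocycles_inl_mul z') fun k γ δ => by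
    rw [edgeCocycles_apply_inl_mul, hz', add_zero]
  refine ⟨intClass₂ c, Subtype.ext ?_⟩
  change infl S 2 (intClass₂ c) = intClass₂ z.1
  rw [pullback_intClass₂, hc]
  change intClass₂ (z.1 - _) = _
  rw [map_sub, intClass₂_coboundary, sub_zero]

theorem exact_inflH2_edgeMap : Function.Exact (inflH2 S) (edgeMap S) := fun c =>
  ⟨mem_range_inflH2_of_edgeMap_eq_zero c, by rintro ⟨d, rfl⟩; exact edgeMap_inflH2 d⟩

theorem edgeMap_cup (α : H1 (trivZ B)) (x : H1 (trivZ Γ)) (hF : cup (infl S 1 α) x ∈ filtH2 S)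
    (w : invH1 S) (hw : (w : H1 (trivZ H)) = restr S 1 x) :
    edgeMap S ⟨cup (infl S 1 α) x, hF⟩ = cupInv (monodromyRep S) α w := by
  let z : edgeCocycles S := ⟨cupCocycle (infl S 1 α) x, fun h γ => by
    change val₁ (infl S 1 α) _ * _ = 0
    rw [val₁_pullback, S.rightHom_inl, val₁_one, zero_mul]⟩
  change edgeMap S (edgeClass S z) = _
  rw [edgeMap_edgeClass]
  refine congrArg (H1π (monodromyRep S)) (evalCocycle_ext S fun γ h => ?_)
  rw [evalCocycle_edgeHom]
  change val₁ (infl S 1 α) γ * val₁ x (γ⁻¹ * S.inl h * γ) =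
    val₁ (val₁ α (S.rightHom γ) • (w : H1 (trivZ H))) h
  rw [val₁_zsmul, hw, val₁_pullback, val₁_pullback]
  simp

end LHS

/-! ### Crossed modules and surjectivity of the edge map -/

section CrossedModules

/-- Every crossed module `d : N → Γ` with cokernel `B` is split by a group extension: `N` embeds as
a normal subgroup of a group `E` mapping onto `Γ`, so that `E` acts on `N` by conjugation through
the given action of `Γ`, and the kernel of `E → Γ` is contained in `N`. Equivalently, the
characteristic class of the crossed module in `H³(B, ker d)` is zero. -/
def SplitsCrossedModules (B : Type) [Group B] : Prop :=
  ∀ (N Γ : Type) [Group N] [Group Γ] (d : N →* Γ) (φ : Γ →* MulAut N) (p : Γ →* B),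
    Function.Surjective p → d.range = p.ker →
    (∀ γ n, d (φ γ n) = γ * d n * γ⁻¹) → (∀ m n, φ (d m) n = m * n * m⁻¹) →
    ∃ (E : Type) (_ : Group E) (ι : N →* E) (q : E →* Γ), Function.Injective ι ∧
      (∀ n, q (ι n) = d n) ∧ (∀ e n, e * ι n * e⁻¹ = ι (φ (q e) n)) ∧
      Function.Surjective q ∧ ∀ e, q e = 1 → e ∈ ι.range

variable {H Γ B : Type} [Group H] [Group Γ] [Group B] (S : GroupExtension H Γ B)

/-- The action `γ · (h, n) = (γ h γ⁻¹, n + u(γ)(γ h γ⁻¹))` of `Γ` on `H × ℤ` determined by a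
`1`-cocycle `u : B → H¹(H, ℤ)`. -/
def twistedEnd (u : cocycles₁ (monodromyRep S)) (γ : Γ) :
    H × Multiplicative ℤ →* H × Multiplicative ℤ where
  toFun x := (S.conjAct γ x.1,
    x.2 * Multiplicative.ofAdd (evalCocycle S u (S.rightHom γ) (S.conjAct γ x.1)))
  map_one' := by
    have h : evalCocycle S u (S.rightHom γ) 1 = 0 := val₁_one _
    simp [h]
  map_mul' x y := by
    simp only [Prod.fst_mul, Prod.snd_mul, map_mul, evalCocycle_hom, ofAdd_add, Prod.mk_mul_mk]
    rw [mul_mul_mul_comm]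

theorem evalCocycle_one (u : cocycles₁ (monodromyRep S)) (h : H) :
    evalCocycle S u 1 h = 0 := by
  have := evalCocycle_mul S u 1 1 h
  simpa using this

theorem twistedEnd_mul (u : cocycles₁ (monodromyRep S)) (γ δ : Γ) (x : H × Multiplicative ℤ) :
    twistedEnd S u (γ * δ) x = twistedEnd S u γ (twistedEnd S u δ x) := by
  refine Prod.ext (by simp [twistedEnd]) ?_
  simp only [twistedEnd, MonoidHom.coe_mk, OneHom.coe_mk]
  have h₁ : S.conjAct (γ * δ) x.1 = S.conjAct γ (S.conjAct δ x.1) := by simp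
  have h₂ : S.conjAct γ⁻¹ (S.conjAct γ (S.conjAct δ x.1)) = S.conjAct δ x.1 := by simp
  rw [evalCocycle_mul, h₁, h₂, add_comm, ofAdd_add, mul_assoc]

theorem twistedEnd_one (u : cocycles₁ (monodromyRep S)) (x : H × Multiplicative ℤ) :
    twistedEnd S u 1 x = x := by
  simp [twistedEnd, evalCocycle_one]

/-- `twistedEnd` as a homomorphism to the automorphism group. -/
def twistedAction (u : cocycles₁ (monodromyRep S)) : Γ →* MulAut (H × Multiplicative ℤ) where
  toFun γ := (twistedEnd S u γ).toMulEquiv (twistedEnd S u γ⁻¹)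
    (MonoidHom.ext fun x => by
      change twistedEnd S u γ⁻¹ (twistedEnd S u γ x) = x
      rw [← twistedEnd_mul, inv_mul_cancel, twistedEnd_one])
    (MonoidHom.ext fun x => by
      change twistedEnd S u γ (twistedEnd S u γ⁻¹ x) = x
      rw [← twistedEnd_mul, mul_inv_cancel, twistedEnd_one])
  map_one' := MulEquiv.ext fun x => twistedEnd_one S u x
  map_mul' γ δ := MulEquiv.ext fun x => twistedEnd_mul S u γ δ x

theorem twistedAction_apply (u : cocycles₁ (monodromyRep S)) (γ : Γ) (x : H × Multiplicative ℤ) :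
    twistedAction S u γ x = (S.conjAct γ x.1,
      x.2 * Multiplicative.ofAdd (evalCocycle S u (S.rightHom γ) (S.conjAct γ x.1))) := rfl

/-- A `1`-cocycle `u` turns `H × ℤ → Γ` into a crossed module with cokernel `B`. A group `E`
splitting it is a central extension of `Γ` by `ℤ`, whose cocycle has image `u`. -/
theorem edgeHom_surjective (hB : SplitsCrossedModules B) : Function.Surjective (edgeHom S) := by
  intro u
  obtain ⟨E, _, ι, q, hι, hq, hconj, hsurj, hker⟩ := hB (H × Multiplicative ℤ) Γ
    (S.inl.comp (MonoidHom.fst H (Multiplicative ℤ))) (twistedAction S u) S.rightHom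
    S.rightHom_surjective
    (by
      rw [← S.range_inl_eq_ker_rightHom]
      ext γ
      constructor
      · rintro ⟨x, rfl⟩
        exact ⟨x.1, rfl⟩
      · rintro ⟨h, rfl⟩
        exact ⟨(h, 1), rfl⟩)
    (fun γ n => by
      rw [twistedAction_apply]
      change S.inl (S.conjAct γ n.1) = γ * S.inl n.1 * γ⁻¹
      rw [S.inl_conjAct_comm])
    (fun m n => by
      rw [twistedAction_apply]
      change (S.conjAct (S.inl m.1) n.1, n.2 * Multiplicative.ofAdd
        (evalCocycle S u (S.rightHom (S.inl m.1)) _)) = _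
      rw [S.rightHom_inl, evalCocycle_one]
      refine Prod.ext (S.inl_injective ?_) ?_
      · rw [S.inl_conjAct_comm]
        simp
      · change n.2 * Multiplicative.ofAdd 0 = m.2 * n.2 * m.2⁻¹
        simp)
  replace hq : ∀ h n, q (ι (h, n)) = S.inl h := fun h n => hq (h, n)
  let c : ℤ → E := fun n => ι (1, Multiplicative.ofAdd n)
  have hc_add : ∀ m n, c (m + n) = c m * c n := fun m n => by
    simp only [c]
    rw [← map_mul, Prod.mk_mul_mk, one_mul, ofAdd_add]
  have hc_inj : Function.Injective c := fun m n h =>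
    Multiplicative.ofAdd.injective (congrArg Prod.snd (hι h))
  have hc_comm : ∀ n e, e * c n = c n * e := fun n e => by
    have h₁ := hconj e (1, Multiplicative.ofAdd n)
    have h₂ : evalCocycle S u (S.rightHom (q e)) 1 = 0 := val₁_one _
    rw [twistedAction_apply, map_one, h₂, ofAdd_zero, mul_one, mul_inv_eq_iff_eq_mul] at h₁
    exact h₁
  -- a section of `E → Γ` which is equivariant for `H` and extends the inclusion of `H`
  obtain ⟨s, hsq, hsH, hs⟩ : ∃ s : Γ → E, (∀ γ, q (s γ) = γ) ∧ (∀ h, s (S.inl h) = ι (h, 1)) ∧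
      ∀ h γ, s (S.inl h * γ) = ι (h, 1) * s γ := by
    obtain ⟨κ, hκ1, hκ⟩ := exists_retraction S
    have ht := Function.surjInv_eq hsurj
    set t := Function.surjInv hsurj
    have hs : ∀ h γ, ι (κ (S.inl h * γ), 1) * t ((S.inl (κ (S.inl h * γ)))⁻¹ * (S.inl h * γ)) =
        ι (h, 1) * (ι (κ γ, 1) * t ((S.inl (κ γ))⁻¹ * γ)) := fun h γ => by
      rw [hκ, ← mul_assoc (ι (h, 1)), ← map_mul, Prod.mk_mul_mk, one_mul]
      congr 2
      rw [map_mul]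
      group
    refine ⟨fun γ => ι (κ γ, 1) * t ((S.inl (κ γ))⁻¹ * γ) * (t 1)⁻¹, fun γ => ?_, fun h => ?_,
      fun h γ => ?_⟩
    · simp only [map_mul, map_inv, hq, ht]
      group
    · have h₁ := hs h 1
      rw [mul_one, hκ1, map_one] at h₁
      have h₂ : ι ((1 : H), (1 : Multiplicative ℤ)) = 1 := map_one ι
      dsimp only
      rw [h₁, h₂]
      simp
    · dsimp only
      rw [hs]
      group
  have hz : ∀ γ δ, ∃ n, s γ * s δ = c n * s (γ * δ) := fun γ δ => by
    obtain ⟨⟨h, n⟩, hn⟩ := hker (s γ * s δ * (s (γ * δ))⁻¹) (by simp [hsq])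
    have hh : h = 1 := S.inl_injective (by
      rw [← hq h n, hn]
      simp [hsq])
    refine ⟨n.toAdd, ?_⟩
    rw [hh] at hn
    rw [← mul_inv_eq_iff_eq_mul, ← hn]
    rfl
  choose z hz using hz
  have hz_eq : ∀ {γ δ n}, s γ * s δ = c n * s (γ * δ) → z γ δ = n := fun {γ δ n} h =>
    hc_inj (mul_right_cancel ((hz γ δ).symm.trans h))
  refine ⟨⟨⟨z, fun γ δ ε => ?_⟩, fun h γ => ?_⟩, evalCocycle_ext S fun γ h => ?_⟩
  · apply hc_inj
    have h₁ : s γ * s δ * s ε = c (z γ δ + z (γ * δ) ε) * s (γ * (δ * ε)) := by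
      rw [hz, mul_assoc, hz, ← mul_assoc, hc_add, mul_assoc γ]
    have h₂ : s γ * (s δ * s ε) = c (z δ ε + z γ (δ * ε)) * s (γ * (δ * ε)) := by
      rw [hz δ, ← mul_assoc, hc_comm, mul_assoc, hz, ← mul_assoc, hc_add]
    rw [add_comm]
    exact mul_right_cancel (h₁.symm.trans ((mul_assoc _ _ _).trans h₂))
  · refine hz_eq ?_
    rw [hsH, hs]
    have : c 0 = 1 := map_one ι
    rw [this, one_mul]
  · rw [evalCocycle_edgeHom]
    refine hz_eq ?_
    have h₁ : γ * (γ⁻¹ * S.inl h * γ) = S.inl h * γ := by group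
    have h₂ : S.conjAct γ (S.conjAct γ⁻¹ h) = h := by simp
    have h₃ := hconj (s γ) (S.conjAct γ⁻¹ h, 1)
    rw [hsq, mul_inv_eq_iff_eq_mul, twistedAction_apply, h₂, one_mul] at h₃
    rw [h₁, hs, ← inl_conj, hsH, h₃, ← mul_assoc]
    simp only [c]
    rw [← map_mul, Prod.mk_mul_mk, one_mul, mul_one]

theorem edgeMap_surjective (hB : SplitsCrossedModules B) : Function.Surjective (edgeMap S) := by
  intro c
  induction c using H1_induction_on with
  | h u =>
    obtain ⟨z, rfl⟩ := edgeHom_surjective S hB u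
    exact ⟨edgeClass S z, edgeMap_edgeClass z⟩

end CrossedModules

/-! ### Splitting crossed modules over free groups and HNN extensions -/

section Splitting

theorem IsFreeOfFiniteRank.exists_section {B : Type} [Group B] (hB : IsFreeOfFiniteRank B)
    {E : Type} [Group E] (p : E →* B) (hp : Function.Surjective p) :
    ∃ s : B →* E, ∀ b, p (s b) = b := by
  obtain ⟨n, ⟨e⟩⟩ := hB
  let s₀ : FreeGroup (Fin n) →* E :=
    FreeGroup.lift fun i => Function.surjInv hp (e.symm (FreeGroup.of i))
  have hs₀ : p.comp s₀ = e.symm.toMonoidHom := FreeGroup.ext_hom _ _ fun i => by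
    simp [s₀, Function.surjInv_eq hp]
  exact ⟨s₀.comp e.toMonoidHom, fun b => by
    simpa using DFunLike.congr_fun hs₀ (e b)⟩

section Semidirect
variable {N Γ F : Type} [Group N] [Group Γ] [Group F] (d : N →* Γ) (φ : Γ →* MulAut N)
  (hd : ∀ γ n, d (φ γ n) = γ * d n * γ⁻¹) (f : F →* Γ)

/-- The homomorphism `(n, x) ↦ d(n) f(x)` to `Γ` from the semidirect product of `N` by a group `F`
acting on `N` through `Γ`. -/
def semidirectToBase : N ⋊[φ.comp f] F →* Γ :=
  SemidirectProduct.lift d f fun x => MonoidHom.ext fun n => hd (f x) n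

theorem semidirectToBase_inl (n : N) :
    semidirectToBase d φ hd f (SemidirectProduct.inl n) = d n :=
  SemidirectProduct.lift_inl ..

theorem semidirectToBase_inr (x : F) :
    semidirectToBase d φ hd f (SemidirectProduct.inr x) = f x :=
  SemidirectProduct.lift_inr ..

theorem semidirect_conj_inl (hφ : ∀ m n, φ (d m) n = m * n * m⁻¹) (e : N ⋊[φ.comp f] F) (n : N) :
    e * SemidirectProduct.inl n * e⁻¹ =
      SemidirectProduct.inl (φ (semidirectToBase d φ hd f e) n) := by
  have h := (SemidirectProduct.inl_aut (φ := φ.comp f) e.right n).symm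
  have he := SemidirectProduct.inl_left_mul_inr_right e
  rw [← he, map_mul, semidirectToBase_inl, semidirectToBase_inr, map_mul, MulAut.mul_apply, hφ,
    map_mul, map_mul, map_inv, mul_inv_rev]
  have h' : SemidirectProduct.inl (φ (f e.right) n) = (SemidirectProduct.inr e.right *
    SemidirectProduct.inl n * (SemidirectProduct.inr e.right)⁻¹ : N ⋊[φ.comp f] F) := by
    rw [← map_inv]; exact h.symm
  rw [h']
  group

end Semidirect

theorem IsFreeOfFiniteRank.splitsCrossedModules {B : Type} [Group B] (hB : IsFreeOfFiniteRank B) :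
    SplitsCrossedModules B := by
  intro N Γ _ _ d φ p hp hrange hd hφ
  obtain ⟨s, hs⟩ := hB.exists_section p hp
  refine ⟨N ⋊[φ.comp s] B, inferInstance, SemidirectProduct.inl, semidirectToBase d φ hd s,
    SemidirectProduct.inl_injective, semidirectToBase_inl d φ hd s,
    semidirect_conj_inl d φ hd s hφ, fun γ => ?_, fun e he => ?_⟩
  · have h₁ : γ * (s (p γ))⁻¹ ∈ d.range := by
      rw [hrange, MonoidHom.mem_ker]
      simp [hs]
    obtain ⟨n, hn⟩ := h₁
    refine ⟨SemidirectProduct.inl n * SemidirectProduct.inr (p γ), ?_⟩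
    rw [map_mul, semidirectToBase_inl, semidirectToBase_inr, hn]
    simp
  · have hd1 : p (d e.left) = 1 := by
      rw [← MonoidHom.mem_ker, ← hrange]
      exact ⟨_, rfl⟩
    rw [← SemidirectProduct.inl_left_mul_inr_right e, map_mul, semidirectToBase_inl,
      semidirectToBase_inr] at he
    have h₁ := congrArg p he
    rw [map_mul, hd1, hs, one_mul, map_one] at h₁
    exact ⟨e.left, by
      conv_rhs => rw [← SemidirectProduct.inl_left_mul_inr_right e]
      rw [h₁, map_one, mul_one]⟩

/-- A group `B` which is an HNN extension `⟨F, b | b a b⁻¹ = w⟩` of a free group `F`, where `a` and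
`w` both have image `1` under some homomorphism `χ : F → ℤ`, splits crossed modules. The splitting
group is an HNN extension of `N ⋊ F`, whose associated subgroups are two copies of `N ⋊ ℤ`. -/
theorem splitsCrossedModules_of_hnn {B X : Type} [Group B] (f : FreeGroup X →* B) (b : B)
    (a w : FreeGroup X) (χ : FreeGroup X →* Multiplicative ℤ)
    (ha : χ a = Multiplicative.ofAdd 1) (hw : χ w = Multiplicative.ofAdd 1)
    (hrel : b * f a * b⁻¹ = f w) (hgen : f.range ⊔ Subgroup.zpowers b = ⊤)
    (huniv : ∀ (Q : Type) [Group Q] (g : FreeGroup X →* Q) (t : Q), t * g a * t⁻¹ = g w →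
      ∃ ψ : B →* Q, (∀ x, ψ (f x) = g x) ∧ ψ b = t) :
    SplitsCrossedModules B := by
  intro N Γ _ _ d φ p hp hrange hd hφ
  have hpd : ∀ n, p (d n) = 1 := fun n => by
    rw [← MonoidHom.mem_ker, ← hrange]
    exact ⟨_, rfl⟩
  obtain ⟨b', hb'⟩ := hp b
  obtain ⟨f', hf'⟩ : ∃ f' : FreeGroup X →* Γ, ∀ x, p (f' x) = f x := by
    let f' : FreeGroup X →* Γ := FreeGroup.lift fun i => Function.surjInv hp (f (FreeGroup.of i))
    have : p.comp f' = f := FreeGroup.ext_hom _ _ fun i => by simp [f', Function.surjInv_eq hp]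
    exact ⟨f', DFunLike.congr_fun this⟩
  obtain ⟨m, hm⟩ : ∃ m, d m = b' * f' a * b'⁻¹ * (f' w)⁻¹ := by
    have : b' * f' a * b'⁻¹ * (f' w)⁻¹ ∈ d.range := by
      rw [hrange, MonoidHom.mem_ker]
      simp [hb', hf', ← hrel]
    exact this
  let E := N ⋊[φ.comp f'] FreeGroup X
  let q₁ : E →* Γ := semidirectToBase d φ hd f'
  have hq₁l : ∀ n, q₁ (SemidirectProduct.inl n) = d n := semidirectToBase_inl d φ hd f'
  have hq₁r : ∀ x, q₁ (SemidirectProduct.inr x) = f' x := semidirectToBase_inr d φ hd f'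
  have hE : ∀ (e : E) n, e * SemidirectProduct.inl n * e⁻¹ = SemidirectProduct.inl (φ (q₁ e) n) :=
    semidirect_conj_inl d φ hd f' hφ
  let K := N ⋊[(φ.comp f').comp (zpowersHom _ a)] Multiplicative ℤ
  -- the two embeddings of `N ⋊ ℤ` in `N ⋊ F`
  let j₁ : K →* E := SemidirectProduct.lift SemidirectProduct.inl
    (SemidirectProduct.inr.comp (zpowersHom _ a)) fun x => MonoidHom.ext fun n => by
      have h := hE (SemidirectProduct.inr (zpowersHom _ a x)) n
      rw [hq₁r] at h
      exact h.symm
  let w' : E := SemidirectProduct.inl m * SemidirectProduct.inr w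
  have hw' : q₁.comp (zpowersHom _ w') =
      (MulAut.conj b').toMonoidHom.comp (f'.comp (zpowersHom _ a)) := MonoidHom.ext_mint (by
    simp [w', hq₁l, hq₁r, hm])
  let j₂ : K →* E := SemidirectProduct.lift (SemidirectProduct.inl.comp (φ b').toMonoidHom)
    (zpowersHom _ w') fun x => MonoidHom.ext fun n => by
      have h := hE (zpowersHom _ w' x) (φ b' n)
      have hx : q₁ (zpowersHom _ w' x) = b' * f' (zpowersHom _ a x) * b'⁻¹ :=
        DFunLike.congr_fun hw' x
      have h₁ : φ (b' * f' (zpowersHom _ a x) * b'⁻¹) (φ b' n) =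
          φ b' (φ (f' (zpowersHom _ a x)) n) := by
        rw [← MulAut.mul_apply, ← MulAut.mul_apply, ← map_mul, ← map_mul]
        simp
      rw [hx, h₁] at h
      exact h.symm
  have hj₁l : ∀ n, j₁ (SemidirectProduct.inl n) = SemidirectProduct.inl n :=
    SemidirectProduct.lift_inl _ _ _
  have hj₁r : ∀ x, j₁ (SemidirectProduct.inr x) = SemidirectProduct.inr (zpowersHom _ a x) :=
    SemidirectProduct.lift_inr _ _ _
  have hj₂l : ∀ n, j₂ (SemidirectProduct.inl n) = SemidirectProduct.inl (φ b' n) :=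
    SemidirectProduct.lift_inl _ _ _
  have hj₂r : ∀ x, j₂ (SemidirectProduct.inr x) = zpowersHom _ w' x :=
    SemidirectProduct.lift_inr _ _ _
  have hχ₁ : ∀ k : K, χ (j₁ k).right = k.right := fun k => by
    have : χ.comp (SemidirectProduct.rightHom.comp j₁) = SemidirectProduct.rightHom := by
      refine SemidirectProduct.hom_ext (MonoidHom.ext fun n => ?_) (MonoidHom.ext_mint ?_)
      · simp [hj₁l]
      · simp [hj₁r, ha]
    exact DFunLike.congr_fun this k
  have hχ₂ : ∀ k : K, χ (j₂ k).right = k.right := fun k => by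
    have : χ.comp (SemidirectProduct.rightHom.comp j₂) = SemidirectProduct.rightHom := by
      refine SemidirectProduct.hom_ext (MonoidHom.ext fun n => ?_) (MonoidHom.ext_mint ?_)
      · simp [hj₂l]
      · change χ (j₂ (SemidirectProduct.inr (Multiplicative.ofAdd 1))).right = Multiplicative.ofAdd 1
        have h₁ : zpowersHom E w' (Multiplicative.ofAdd 1) = w' := by simp
        have h₂ : w'.right = w := one_mul w
        rw [hj₂r, h₁, h₂, hw]
    exact DFunLike.congr_fun this k
  have hj₁ : Function.Injective j₁ := (injective_iff_map_eq_one j₁).2 fun k hk => by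
    have h₁ : k.right = 1 := by rw [← hχ₁, hk]; simp
    have h₂ : k = SemidirectProduct.inl k.left := by
      conv_lhs => rw [← SemidirectProduct.inl_left_mul_inr_right k, h₁, map_one, mul_one]
    rw [h₂, hj₁l] at hk
    rw [h₂, SemidirectProduct.inl_injective (hk.trans (map_one _).symm), map_one]
  have hj₂ : Function.Injective j₂ := (injective_iff_map_eq_one j₂).2 fun k hk => by
    have h₁ : k.right = 1 := by rw [← hχ₂, hk]; simp
    have h₂ : k = SemidirectProduct.inl k.left := by
      conv_lhs => rw [← SemidirectProduct.inl_left_mul_inr_right k, h₁, map_one, mul_one]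
    rw [h₂, hj₂l] at hk
    have h₃ : φ b' k.left = 1 := SemidirectProduct.inl_injective (hk.trans (map_one _).symm)
    rw [h₂, (map_eq_one_iff _ (φ b').injective).1 h₃, map_one]
  let Φ : j₁.range ≃* j₂.range :=
    (MonoidHom.ofInjective hj₁).symm.trans (MonoidHom.ofInjective hj₂)
  have hΦk : ∀ k, (Φ (MonoidHom.ofInjective hj₁ k) : E) = j₂ k := fun k => by
    change (MonoidHom.ofInjective hj₂ ((MonoidHom.ofInjective hj₁).symm
      (MonoidHom.ofInjective hj₁ k)) : E) = j₂ k
    rw [MulEquiv.symm_apply_apply]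
    rfl
  have hΦ : ∀ x : j₁.range, ∃ k, (x : E) = j₁ k ∧ (Φ x : E) = j₂ k := by
    intro x
    obtain ⟨k, rfl⟩ := (MonoidHom.ofInjective hj₁).surjective x
    exact ⟨k, rfl, hΦk k⟩
  let P := HNNExtension E j₁.range j₂.range Φ
  let of : E →* P := HNNExtension.of
  let t : P := HNNExtension.t
  have ht : ∀ k, t * of (j₁ k) = of (j₂ k) * t := fun k => by
    have h := HNNExtension.t_mul_of (φ := Φ) (MonoidHom.ofInjective hj₁ k)
    rw [hΦk] at h
    exact h
  have hqj : ∀ k, b' * q₁ (j₁ k) = q₁ (j₂ k) * b' := fun k => by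
    have : (MulAut.conj b').toMonoidHom.comp (q₁.comp j₁) = q₁.comp j₂ := by
      refine SemidirectProduct.hom_ext (MonoidHom.ext fun n => ?_) ?_
      · simp [hj₁l, hj₂l, hq₁l, hd]
      · refine MonoidHom.ext fun x => ?_
        have hx : q₁ (zpowersHom _ w' x) = b' * f' (zpowersHom _ a x) * b'⁻¹ :=
          DFunLike.congr_fun hw' x
        change b' * q₁ (j₁ (SemidirectProduct.inr x)) * b'⁻¹ = q₁ (j₂ (SemidirectProduct.inr x))
        rw [hj₁r, hj₂r, hx, hq₁r]
    have h := DFunLike.congr_fun this k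
    rw [← mul_inv_eq_iff_eq_mul]
    exact h
  let q : P →* Γ := HNNExtension.lift q₁ b' fun x => by
    obtain ⟨k, hk, hk'⟩ := hΦ x
    rw [hk, hk', hqj]
  have hqof : ∀ e, q (of e) = q₁ e := HNNExtension.lift_of _ _ _
  have hqt : q t = b' := HNNExtension.lift_t _ _ _
  let ι : N →* P := of.comp SemidirectProduct.inl
  have hconj : ∀ e n, e * ι n * e⁻¹ = ι (φ (q e) n) := fun e => by
    induction e using HNNExtension.induction_on with
    | of e =>
      intro n
      change of e * of _ * (of e)⁻¹ = of _
      rw [← map_mul, ← map_inv, ← map_mul, hE]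
      exact congrArg (fun x => of (SemidirectProduct.inl (φ x n))) (hqof e).symm
    | t =>
      intro n
      change t * of _ * t⁻¹ = of _
      rw [← hj₁l, ht, hj₂l, mul_inv_cancel_right]
      exact congrArg (fun x => of (SemidirectProduct.inl (φ x n))) hqt.symm
    | mul x y hx hy =>
      intro n
      rw [map_mul, map_mul, MulAut.mul_apply, ← hx, ← hy]
      group
    | inv x hx =>
      intro n
      have h := hx (φ (q x)⁻¹ n)
      rw [← MulAut.mul_apply, ← map_mul, mul_inv_cancel, map_one, MulAut.one_apply] at h
      rw [map_inv, ← h]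
      group
  have : ι.range.Normal := ⟨by
    rintro _ ⟨n, rfl⟩ e
    exact ⟨_, (hconj e n).symm⟩⟩
  -- `B` maps to `P ⧸ N` by its universal property
  obtain ⟨ψ, hψf, hψb⟩ := huniv (P ⧸ ι.range)
    ((QuotientGroup.mk' ι.range).comp (of.comp SemidirectProduct.inr))
    (QuotientGroup.mk' ι.range t) (by
      have h₁ := ht (SemidirectProduct.inr (Multiplicative.ofAdd 1))
      rw [hj₁r, hj₂r] at h₁
      have h₂ : zpowersHom (FreeGroup X) a (Multiplicative.ofAdd 1) = a := by simp
      have h₃ : zpowersHom E w' (Multiplicative.ofAdd 1) = w' := by simp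
      rw [h₂, h₃] at h₁
      rw [mul_inv_eq_iff_eq_mul]
      refine Eq.trans (map_mul (QuotientGroup.mk' ι.range) _ _).symm ?_
      refine (congrArg (QuotientGroup.mk' ι.range) h₁).trans ?_
      have h₄ : QuotientGroup.mk' ι.range (of (SemidirectProduct.inl m)) = 1 :=
        (QuotientGroup.eq_one_iff _).2 ⟨m, rfl⟩
      simp only [w', map_mul, h₄, one_mul]
      rfl)
  have hψ : ψ.comp (p.comp q) = QuotientGroup.mk' ι.range := by
    refine HNNExtension.hom_ext (SemidirectProduct.hom_ext (MonoidHom.ext fun n => ?_)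
      (MonoidHom.ext fun x => ?_)) ?_
    · have h₄ : QuotientGroup.mk' ι.range (of (SemidirectProduct.inl n)) = 1 :=
        (QuotientGroup.eq_one_iff _).2 ⟨n, rfl⟩
      refine Eq.trans ?_ h₄.symm
      change ψ (p (q (of _))) = 1
      rw [hqof, hq₁l, hpd, map_one]
    · change ψ (p (q (of _))) = QuotientGroup.mk' ι.range (of (SemidirectProduct.inr x))
      rw [hqof, hq₁r, hf', hψf]
      rfl
    · change ψ (p (q t)) = QuotientGroup.mk' ι.range t
      rw [hqt, hb', hψb]
  refine ⟨P, inferInstance, ι, q, fun n n' h => SemidirectProduct.inl_injective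
    (HNNExtension.of_injective Φ h), fun n => (hqof _).trans (hq₁l n), hconj, ?_, fun e he => ?_⟩
  · have hN : p.ker ≤ q.range := by
      rw [← hrange]
      rintro _ ⟨n, rfl⟩
      exact ⟨ι n, (hqof _).trans (hq₁l n)⟩
    have hpq : (p.comp q).range = ⊤ := by
      rw [eq_top_iff, ← hgen, sup_le_iff, Subgroup.zpowers_le]
      refine ⟨?_, ⟨t, ?_⟩⟩
      · rintro _ ⟨x, rfl⟩
        refine ⟨of (SemidirectProduct.inr x), ?_⟩
        change p (q (of _)) = _
        rw [hqof, hq₁r, hf']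
      · change p (q t) = b
        rw [hqt, hb']
    intro γ
    obtain ⟨e, he⟩ : p γ ∈ (p.comp q).range := hpq ▸ Subgroup.mem_top _
    have h₁ : γ * (q e)⁻¹ ∈ p.ker := by
      rw [MonoidHom.mem_ker, map_mul, map_inv, ← he]
      exact mul_inv_cancel _
    obtain ⟨e', he'⟩ := hN h₁
    exact ⟨e' * e, by rw [map_mul, he', inv_mul_cancel_right]⟩
  · have h := DFunLike.congr_fun hψ e
    rw [MonoidHom.comp_apply, MonoidHom.comp_apply, he, map_one, map_one] at h
    exact (QuotientGroup.eq_one_iff _).1 h.symm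

theorem SplitsCrossedModules.of_mulEquiv {B B' : Type} [Group B] [Group B'] (e : B' ≃* B)
    (hB : SplitsCrossedModules B) : SplitsCrossedModules B' := by
  intro N Γ _ _ d φ p hp hrange
  refine hB N Γ d φ (e.toMonoidHom.comp p) (e.surjective.comp hp) ?_
  rw [hrange]
  ext γ
  simp [MonoidHom.mem_ker]

end Splitting

/-! ### Surface groups: splitting and duality -/

section SurfaceSplitting

theorem surfaceRelator_succ (k : ℕ) {Q : Type} [Group Q]
    (g : Fin (k + 1) ⊕ Fin (k + 1) → Q) :
    FreeGroup.lift g (surfaceRelator (k + 1)) =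
      g (Sum.inl 0) * g (Sum.inr 0) * (g (Sum.inl 0))⁻¹ * (g (Sum.inr 0))⁻¹ *
        (List.ofFn fun i : Fin k => g (Sum.inl i.succ) * g (Sum.inr i.succ) *
          (g (Sum.inl i.succ))⁻¹ * (g (Sum.inr i.succ))⁻¹).prod := by
  simp [surfaceRelator, map_list_prod, List.map_ofFn, List.ofFn_succ, Function.comp_def]

theorem lift_surfaceRelator_presentedGroup (g : ℕ) :
    FreeGroup.lift (fun x => (PresentedGroup.of x : SurfaceGroup g)) (surfaceRelator g) = 1 := by
  have h : FreeGroup.lift (fun x => (PresentedGroup.of x : SurfaceGroup g)) =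
      PresentedGroup.mk {surfaceRelator g} := FreeGroup.ext_hom _ _ fun x => by
    rw [FreeGroup.lift_apply_of]; rfl
  rw [h]
  exact PresentedGroup.one_of_mem rfl

/-- The relation of `Π_g` reads `b₁ a₁ b₁⁻¹ = [a₂, b₂] ⋯ [a_g, b_g] a₁`: the surface group is an HNN
extension of the free group on the generators other than `b₁`. -/
theorem splitsCrossedModules_surfaceGroup (k : ℕ) : SplitsCrossedModules (SurfaceGroup (k + 1)) := by
  let of : Fin (k + 1) ⊕ Fin (k + 1) → SurfaceGroup (k + 1) := PresentedGroup.of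
  let a : FreeGroup (Fin (k + 1) ⊕ Fin k) := FreeGroup.of (Sum.inl 0)
  let W : FreeGroup (Fin (k + 1) ⊕ Fin k) := (List.ofFn fun i : Fin k =>
    FreeGroup.of (Sum.inl i.succ : Fin (k + 1) ⊕ Fin k) * FreeGroup.of (Sum.inr i) *
      (FreeGroup.of (Sum.inl i.succ))⁻¹ * (FreeGroup.of (Sum.inr i))⁻¹).prod
  have hW : ∀ (Q : Type) [Group Q] (g : Fin (k + 1) ⊕ Fin k → Q), FreeGroup.lift g W =
      (List.ofFn fun i : Fin k => g (Sum.inl i.succ) * g (Sum.inr i) *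
          (g (Sum.inl i.succ))⁻¹ * (g (Sum.inr i))⁻¹).prod := fun Q _ g => by
    simp [W, map_list_prod, List.map_ofFn, Function.comp_def]
  let f : FreeGroup (Fin (k + 1) ⊕ Fin k) →* SurfaceGroup (k + 1) :=
    FreeGroup.lift (Sum.elim (fun i => of (Sum.inl i)) fun i => of (Sum.inr i.succ))
  have hfl : ∀ i, f (FreeGroup.of (Sum.inl i)) = of (Sum.inl i) := fun i =>
    FreeGroup.lift_apply_of
  have hfr : ∀ i, f (FreeGroup.of (Sum.inr i)) = of (Sum.inr i.succ) := fun i =>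
    FreeGroup.lift_apply_of
  -- `χ` is the dual class of `a₁`
  let χ : FreeGroup (Fin (k + 1) ⊕ Fin k) →* Multiplicative ℤ :=
    FreeGroup.lift (Sum.elim (Pi.mulSingle 0 (Multiplicative.ofAdd 1)) 1)
  have ha : χ a = Multiplicative.ofAdd 1 := by simp [χ, a]
  have hχW : χ W = 1 := by
    rw [hW, List.prod_eq_one]
    intro x hx
    rw [List.mem_ofFn] at hx
    obtain ⟨i, rfl⟩ := hx
    simp
  refine splitsCrossedModules_of_hnn f (of (Sum.inr 0)) a (W * a) χ ha
    (by rw [map_mul, hχW, ha, one_mul]) ?_ ?_ ?_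
  · have h := (surfaceRelator_succ k of).symm.trans (lift_surfaceRelator_presentedGroup (k + 1))
    have hfW := hW _ (Sum.elim (fun i => of (Sum.inl i)) fun i => of (Sum.inr i.succ))
    simp only [Sum.elim_inl, Sum.elim_inr] at hfW
    rw [← hfW] at h
    change _ * f W = 1 at h
    rw [map_mul, eq_inv_of_mul_eq_one_right h, hfl]
    group
  · rw [eq_top_iff, ← PresentedGroup.closure_range_of, Subgroup.closure_le]
    rintro _ ⟨i | i, rfl⟩
    · exact Subgroup.mem_sup_left ⟨_, hfl i⟩
    · refine Fin.cases ?_ (fun i => ?_) i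
      · exact Subgroup.mem_sup_right (Subgroup.mem_zpowers _)
      · exact Subgroup.mem_sup_left ⟨_, hfr i⟩
  · intro Q _ g t ht
    let G : Fin (k + 1) ⊕ Fin (k + 1) → Q := Sum.elim (fun i => g (FreeGroup.of (Sum.inl i)))
      (Fin.cons t fun i => g (FreeGroup.of (Sum.inr i)))
    have hG : ∀ r ∈ ({surfaceRelator (k + 1)} : Set (FreeGroup _)), FreeGroup.lift G r = 1 := by
      rintro _ rfl
      have hgW := hW _ fun x => g (FreeGroup.of x)
      have hg : FreeGroup.lift (fun x => g (FreeGroup.of x)) = g :=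
        FreeGroup.ext_hom _ _ fun x => FreeGroup.lift_apply_of
      rw [hg] at hgW
      rw [surfaceRelator_succ]
      simp only [G, Sum.elim_inl, Sum.elim_inr, Fin.cons_zero, Fin.cons_succ]
      rw [← hgW]
      have h₁ : g W = t * g a * t⁻¹ * (g a)⁻¹ := by rw [ht, map_mul]; group
      rw [h₁]
      change g a * t * (g a)⁻¹ * t⁻¹ * _ = 1
      group
    refine ⟨PresentedGroup.toGroup hG, ?_, ?_⟩
    · have : (PresentedGroup.toGroup hG).comp f = g := FreeGroup.ext_hom _ _ fun x => by
        rw [MonoidHom.comp_apply]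
        rcases x with i | i
        · rw [hfl]
          exact PresentedGroup.toGroup.of hG
        · rw [hfr]
          exact PresentedGroup.toGroup.of hG
      exact DFunLike.congr_fun this
    · exact PresentedGroup.toGroup.of hG

theorem IsHyperbolicSurfaceGroup.splitsCrossedModules {B : Type} [Group B]
    (hB : IsHyperbolicSurfaceGroup B) : SplitsCrossedModules B := by
  obtain ⟨g, hg, ⟨e⟩⟩ := hB
  obtain ⟨k, rfl⟩ : ∃ k, g = k + 1 := ⟨g - 1, by omega⟩
  exact (splitsCrossedModules_surfaceGroup k).of_mulEquiv e

end SurfaceSplitting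

section Free

variable {G : Type} [Group G]

/-- The central extension of `G` by `ℤ` determined by an integer `2`-cocycle. -/
@[ext]
structure CentralExt (z : intCocycles₂ G) where
  /-- The component in `ℤ`. -/
  int : ℤ
  /-- The image in `G`. -/
  base : G

namespace CentralExt
variable (z : intCocycles₂ G)

instance : Mul (CentralExt z) := ⟨fun x y => ⟨x.int + y.int + z.1 x.base y.base, x.base * y.base⟩⟩
-- the cocycle is not assumed to be normalised
instance : One (CentralExt z) := ⟨⟨-z.1 1 1, 1⟩⟩
instance : Inv (CentralExt z) := ⟨fun x => ⟨-x.int - z.1 x.base⁻¹ x.base - z.1 1 1, x.base⁻¹⟩⟩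

instance : Group (CentralExt z) := Group.ofLeftAxioms
  (fun x y w => by
    refine CentralExt.ext ?_ (mul_assoc _ _ _)
    change x.int + y.int + z.1 x.base y.base + w.int + z.1 (x.base * y.base) w.base =
      x.int + (y.int + w.int + z.1 y.base w.base) + z.1 x.base (y.base * w.base)
    have := intCocycles₂_apply z x.base y.base w.base
    linarith)
  (fun x => by
    refine CentralExt.ext ?_ (one_mul _)
    change -z.1 1 1 + x.int + z.1 1 x.base = x.int
    have := intCocycles₂_apply z 1 1 x.base
    simp only [one_mul] at this
    linarith)
  (fun x => by
    refine CentralExt.ext ?_ (inv_mul_cancel _)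
    change -x.int - z.1 x.base⁻¹ x.base - z.1 1 1 + x.int + z.1 x.base⁻¹ x.base = -z.1 1 1
    ring)

/-- The projection of the central extension to `G`. -/
def proj : CentralExt z →* G := MonoidHom.mk' base fun _ _ => rfl

end CentralExt

theorem IsFreeOfFiniteRank.H2_eq_zero (hG : IsFreeOfFiniteRank G) (c : H2 (trivZ G)) : c = 0 := by
  obtain ⟨z, rfl⟩ := intClass₂_surjective c
  obtain ⟨s, hs⟩ := hG.exists_section (CentralExt.proj z) fun g => ⟨⟨0, g⟩, rfl⟩
  refine (intClass₂_eq_zero_iff z).2 ⟨fun g => -(s g).int, fun g h => ?_⟩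
  have h₁ : (s (g * h)).int = (s g).int + (s h).int + z.1 (s g).base (s h).base :=
    congrArg CentralExt.int (map_mul s g h)
  have h₂ : ∀ g, (s g).base = g := hs
  rw [h₂, h₂] at h₁
  linarith

end Free

section Duality

/-- Every homomorphism `H¹(G, ℤ) → H²(G, ℤ)` is the cup product with some class. -/
def CupRepresents (G : Type) [Group G] : Prop :=
  ∀ c : H1 (trivZ G) →+ H2 (trivZ G), ∃ β : H1 (trivZ G), ∀ α, cup α β = c α

theorem IsFreeOfFiniteRank.cupRepresents {G : Type} [Group G] (hG : IsFreeOfFiniteRank G) :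
    CupRepresents G := fun _ => ⟨0, fun _ => (hG.H2_eq_zero _).trans (hG.H2_eq_zero _).symm⟩

theorem pullback_pullback_symm_one {G K : Type} [Group G] [Group K] (e : G ≃* K)
    (x : H1 (trivZ G)) : pullback e.toMonoidHom 1 (pullback e.symm.toMonoidHom 1 x) = x :=
  val₁_ext fun g => by simp [val₁_pullback]

theorem pullback_pullback_symm_two {G K : Type} [Group G] [Group K] (e : G ≃* K)
    (x : H2 (trivZ G)) : pullback e.toMonoidHom 2 (pullback e.symm.toMonoidHom 2 x) = x := by
  obtain ⟨z, rfl⟩ := intClass₂_surjective x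
  rw [pullback_intClass₂, pullback_intClass₂]
  congr 1
  refine Subtype.ext (funext fun g => funext fun h => ?_)
  simp [comapCocycle]

theorem CupRepresents.of_mulEquiv {G K : Type} [Group G] [Group K] (e : G ≃* K)
    (hK : CupRepresents K) : CupRepresents G := fun c => by
  obtain ⟨β, hβ⟩ := hK (((pullback e.symm.toMonoidHom 2).comp c).comp (pullback e.toMonoidHom 1))
  refine ⟨pullback e.toMonoidHom 1 β, fun α => ?_⟩
  have h := congrArg (pullback e.toMonoidHom 2) (hβ (pullback e.symm.toMonoidHom 1 α))
  rw [← cup_pullback] at h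
  simpa only [AddMonoidHom.comp_apply, pullback_pullback_symm_one,
    pullback_pullback_symm_two] using h

variable {X : Type} (r : FreeGroup X)

/-- Pairs of an integer `2`-cocycle `z` of the one-relator group `⟨X | r⟩` and a `1`-cochain of the
free group on `X` whose coboundary is the inflation of `z`. -/
def relatorPairs : AddSubgroup (intCocycles₂ (PresentedGroup {r}) × (FreeGroup X → ℤ)) :=
  AddMonoidHom.ker (AddMonoidHom.mk' (fun p : intCocycles₂ (PresentedGroup {r}) ×
      (FreeGroup X → ℤ) => comapCocycle (PresentedGroup.mk {r}) p.1 - intCoboundary p.2)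
    fun p q => Subtype.ext (funext fun x => funext fun y => by
      change p.1.1 _ _ + q.1.1 _ _ - (p.2 x + q.2 x + (p.2 y + q.2 y) - (p.2 _ + q.2 _)) =
        p.1.1 _ _ - (p.2 x + p.2 y - p.2 _) + (q.1.1 _ _ - (q.2 x + q.2 y - q.2 _))
      ring))

theorem mem_relatorPairs_iff (p : intCocycles₂ (PresentedGroup {r}) × (FreeGroup X → ℤ)) :
    p ∈ relatorPairs r ↔ ∀ x y, p.1.1 (PresentedGroup.mk {r} x) (PresentedGroup.mk {r} y) =
      p.2 x + p.2 y - p.2 (x * y) := by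
  refine sub_eq_zero.trans ⟨fun h x y => congrFun (congrFun (congrArg Subtype.val h) x) y,
    fun h => Subtype.ext (funext fun x => funext fun y => h x y)⟩

/-- The class in `H²` of the first component of a pair. -/
def relatorPairsClass : relatorPairs r →+ H2 (trivZ (PresentedGroup {r})) :=
  intClass₂.comp ((AddMonoidHom.fst _ _).comp (relatorPairs r).subtype)

/-- The value at the relator of the (normalised) second component of a pair. -/
def relatorPairsValue : relatorPairs r →+ ℤ :=
  AddMonoidHom.mk' (fun p => p.1.2 r - p.1.2 1) fun p q => by
    change p.1.2 r + q.1.2 r - (p.1.2 1 + q.1.2 1) = _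
    ring

theorem mk_relator : PresentedGroup.mk {r} r = 1 := PresentedGroup.one_of_mem rfl

theorem relatorPairsClass_surjective (hX : IsFreeOfFiniteRank (FreeGroup X)) :
    Function.Surjective (relatorPairsClass r) := fun c => by
  obtain ⟨z, rfl⟩ := intClass₂_surjective c
  obtain ⟨f, hf⟩ := (intClass₂_eq_zero_iff (comapCocycle (PresentedGroup.mk {r}) z)).1
    (hX.H2_eq_zero _)
  exact ⟨⟨(z, f), (mem_relatorPairs_iff r _).2 hf⟩, rfl⟩

theorem relatorPairsValue_eq_zero (hr : ∀ θ : FreeGroup X →* Multiplicative ℤ, θ r = 1)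
    (p : relatorPairs r) (hp : relatorPairsClass r p = 0) : relatorPairsValue r p = 0 := by
  obtain ⟨⟨z, f⟩, hzf⟩ := p
  rw [mem_relatorPairs_iff] at hzf
  obtain ⟨b, hb⟩ := (intClass₂_eq_zero_iff z).1 hp
  have h₁ := hr (MonoidHom.mk' (fun x => Multiplicative.ofAdd (f x - b (PresentedGroup.mk {r} x)))
    fun x y => by
      rw [← ofAdd_add]
      congr 1
      have := hzf x y
      rw [hb] at this
      rw [map_mul]
      dsimp only at this
      linarith)
  have h₂ : f r - b (PresentedGroup.mk {r} r) = 0 := h₁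
  have h₃ := hzf 1 1
  have h₄ := hb 1 1
  rw [mul_one] at h₃ h₄
  rw [map_one] at h₃
  rw [mk_relator] at h₂
  change f r - f 1 = 0
  dsimp only at h₃
  linarith

/-- A cochain of the free group whose coboundary is inflated from `⟨X | r⟩`, and which is constant on
the relator and the identity, is itself inflated: the elements of the kernel where it takes
the value at the identity form a normal subgroup. -/
theorem relatorPairsClass_eq_zero (p : relatorPairs r) (hp : relatorPairsValue r p = 0) :
    relatorPairsClass r p = 0 := by
  obtain ⟨⟨z, f⟩, hzf⟩ := p
  rw [mem_relatorPairs_iff] at hzf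
  replace hzf : ∀ x y, z.1 (PresentedGroup.mk {r} x) (PresentedGroup.mk {r} y) =
    f x + f y - f (x * y) := hzf
  replace hp : f r - f 1 = 0 := hp
  have hone : z.1 1 1 = f 1 := by
    have := hzf 1 1
    rw [mul_one, map_one] at this
    linarith
  have hl : ∀ b, z.1 1 b = f 1 := fun b => by
    have := intCocycles₂_apply z 1 1 b
    simp only [one_mul] at this
    linarith
  have hr : ∀ b, z.1 b 1 = f 1 := fun b => by
    have := intCocycles₂_apply z b 1 1
    simp only [mul_one] at this
    linarith
  have hfr : ∀ x y, PresentedGroup.mk {r} y = 1 → f (x * y) = f x + f y - f 1 := fun x y hy => by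
    have := hzf x y
    rw [hy, hr] at this
    linarith
  have hfl : ∀ x y, PresentedGroup.mk {r} y = 1 → f (y * x) = f y + f x - f 1 := fun x y hy => by
    have := hzf y x
    rw [hy, hl] at this
    linarith
  let R : Subgroup (FreeGroup X) :=
    { carrier := {y | PresentedGroup.mk {r} y = 1 ∧ f y = f 1}
      one_mem' := ⟨map_one _, rfl⟩
      mul_mem' := fun {x y} hx hy => ⟨by rw [map_mul, hx.1, hy.1, mul_one], by
        rw [hfr x y hy.1, hx.2, hy.2]; ring⟩
      inv_mem' := fun {x} hx => ⟨by rw [map_inv, hx.1, inv_one], by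
        have := hfl x⁻¹ x hx.1
        rw [mul_inv_cancel, hx.2] at this
        linarith⟩ }
  have hR : R.Normal := ⟨fun y hy x => by
    have h₁ : PresentedGroup.mk {r} (x * y * x⁻¹) = 1 := by
      rw [map_mul, map_mul, hy.1, mul_one, map_inv, mul_inv_cancel]
    refine ⟨h₁, ?_⟩
    have h₂ := hfl x _ h₁
    rw [inv_mul_cancel_right, hfr x y hy.1, hy.2] at h₂
    linarith⟩
  have hker : ∀ y, PresentedGroup.mk {r} y = 1 → f y = f 1 := fun y hy =>
    ((Subgroup.normalClosure_le_normal (N := R) (by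
      rintro _ rfl
      exact ⟨mk_relator _, by linarith⟩)) ((QuotientGroup.eq_one_iff y).1 hy)).2
  have hf : ∀ x y, PresentedGroup.mk {r} x = PresentedGroup.mk {r} y → f x = f y := fun x y h => by
    have h₁ : PresentedGroup.mk {r} (y⁻¹ * x) = 1 := by rw [map_mul, h, map_inv, inv_mul_cancel]
    have h₂ := hfr y _ h₁
    rw [mul_inv_cancel_left, hker _ h₁] at h₂
    linarith
  have hsurj : Function.Surjective (PresentedGroup.mk {r}) := PresentedGroup.mk_surjective _
  refine (intClass₂_eq_zero_iff z).2 ⟨fun b => f (Function.surjInv hsurj b), fun b c => ?_⟩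
  obtain ⟨x, rfl⟩ := hsurj b
  obtain ⟨y, rfl⟩ := hsurj c
  dsimp only
  rw [hzf, ← map_mul, hf _ x (Function.surjInv_eq hsurj _), hf _ y (Function.surjInv_eq hsurj _),
    hf _ (x * y) (Function.surjInv_eq hsurj _)]

/-- If the relator is a product of commutators, then evaluating at the relator a cochain of the free
group that bounds a cocycle of `⟨X | r⟩` gives an embedding of `H²(⟨X | r⟩, ℤ)` into `ℤ`. -/
theorem exists_relatorValue (hX : IsFreeOfFiniteRank (FreeGroup X))
    (hr : ∀ θ : FreeGroup X →* Multiplicative ℤ, θ r = 1) :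
    ∃ v : H2 (trivZ (PresentedGroup {r})) →+ ℤ, Function.Injective v ∧
      ∀ p : relatorPairs r, v (relatorPairsClass r p) = relatorPairsValue r p := by
  let v := (relatorPairsClass r).liftOfRightInverse _
    (Function.rightInverse_surjInv (relatorPairsClass_surjective r hX))
    ⟨relatorPairsValue r, fun p hp => relatorPairsValue_eq_zero r hr p hp⟩
  have hv : ∀ p, v (relatorPairsClass r p) = relatorPairsValue r p := fun p =>
    AddMonoidHom.liftOfRightInverse_comp_apply _ _ _ _ _
  refine ⟨v, (injective_iff_map_eq_zero v).2 fun c hc => ?_, hv⟩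
  obtain ⟨p, rfl⟩ := relatorPairsClass_surjective r hX c
  rw [hv] at hc
  exact relatorPairsClass_eq_zero r p hc

/-- The value of a cup product at the relator of a surface group is given by the standard
(up to sign) symplectic form. -/
theorem relator_value_cup (g : ℕ) (α β : H1 (trivZ (SurfaceGroup g)))
    (f : FreeGroup (Fin g ⊕ Fin g) → ℤ)
    (hf : (cupCocycle α β, f) ∈ relatorPairs (surfaceRelator g)) :
    f (surfaceRelator g) - f 1 = ∑ i : Fin g,
      (val₁ α (PresentedGroup.of (Sum.inr i)) * val₁ β (PresentedGroup.of (Sum.inl i)) -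
        val₁ α (PresentedGroup.of (Sum.inl i)) * val₁ β (PresentedGroup.of (Sum.inr i))) := by
  rw [mem_relatorPairs_iff] at hf
  set mk := PresentedGroup.mk {surfaceRelator g}
  replace hf : ∀ x y, val₁ α (mk x) * val₁ β (mk y) = f x + f y - f (x * y) := hf
  have hone : f 1 = 0 := by
    have := hf 1 1
    simp only [map_one, val₁_one, mul_one] at this
    linarith
  have hcomm : ∀ x y, f (x * y * x⁻¹ * y⁻¹) =
      val₁ α (mk y) * val₁ β (mk x) - val₁ α (mk x) * val₁ β (mk y) := fun x y => by
    have h₁ := hf (x * y * x⁻¹ * y⁻¹) (y * x)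
    have h₂ : x * y * x⁻¹ * y⁻¹ * (y * x) = x * y := by group
    have h₃ : val₁ α (mk (x * y * x⁻¹ * y⁻¹)) = 0 := by
      simp only [map_mul, map_inv, val₁_mul, val₁_inv]
      ring
    rw [h₂, h₃] at h₁
    have := hf x y
    have := hf y x
    linarith
  have hprod : ∀ l : List (FreeGroup (Fin g ⊕ Fin g)), (∀ x ∈ l, val₁ α (mk x) = 0) →
      f l.prod = (l.map f).sum := fun l => by
    induction l with
    | nil => intro; simpa using hone
    | cons x l ih =>
      intro h
      have h₁ := hf x l.prod
      rw [h x List.mem_cons_self] at h₁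
      rw [List.prod_cons, List.map_cons, List.sum_cons,
        ← ih fun y hy => h y (List.mem_cons_of_mem _ hy)]
      linarith
  rw [hone, sub_zero]
  refine (hprod (List.ofFn _) ?_).trans ?_
  · intro x hx
    rw [List.mem_ofFn] at hx
    obtain ⟨i, rfl⟩ := hx
    simp only [map_mul, map_inv, val₁_mul, val₁_inv]
    ring
  · rw [List.map_ofFn, List.sum_ofFn]
    exact Finset.sum_congr rfl fun i _ => hcomm _ _

theorem map_surfaceRelator_eq_one {Q : Type} [CommGroup Q] (g : ℕ)
    (θ : FreeGroup (Fin g ⊕ Fin g) →* Q) : θ (surfaceRelator g) = 1 := by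
  rw [surfaceRelator, map_list_prod]
  refine List.prod_eq_one fun x hx => ?_
  simp only [List.map_ofFn, List.mem_ofFn, Function.comp_apply] at hx
  obtain ⟨i, rfl⟩ := hx
  simp only [map_mul, map_inv]
  rw [mul_comm (θ _) (θ (FreeGroup.of (Sum.inr i)))]
  group

theorem exists_val₁_of_eq (g : ℕ) (v : Fin g ⊕ Fin g → ℤ) :
    ∃ x : H1 (trivZ (SurfaceGroup g)), ∀ i, val₁ x (PresentedGroup.of i) = v i := by
  have hr : ∀ r ∈ ({surfaceRelator g} : Set (FreeGroup _)),
      FreeGroup.lift (fun i => Multiplicative.ofAdd (v i)) r = 1 := by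
    rintro _ rfl
    exact map_surfaceRelator_eq_one g _
  obtain ⟨x, hx⟩ := exists_val₁_eq (fun b => (PresentedGroup.toGroup hr b).toAdd)
    fun b c => by rw [map_mul, toAdd_mul]
  exact ⟨x, fun i => by rw [hx, PresentedGroup.toGroup.of]; rfl⟩

theorem val₁_ext_of {g : ℕ} {x y : H1 (trivZ (SurfaceGroup g))}
    (h : ∀ i, val₁ x (PresentedGroup.of i) = val₁ y (PresentedGroup.of i)) : x = y := by
  let φ : H1 (trivZ (SurfaceGroup g)) → SurfaceGroup g →* Multiplicative ℤ := fun x =>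
    MonoidHom.mk' (fun b => Multiplicative.ofAdd (val₁ x b)) fun b c => by
      rw [val₁_mul, ofAdd_add]
  have hφ : φ x = φ y := PresentedGroup.ext fun i => congrArg Multiplicative.ofAdd (h i)
  exact val₁_ext fun b => Multiplicative.ofAdd.injective (DFunLike.congr_fun hφ b)

/-- Poincaré duality for surface groups. -/
theorem cupRepresents_surfaceGroup (g : ℕ) : CupRepresents (SurfaceGroup g) := fun c => by
  have hX : IsFreeOfFiniteRank (FreeGroup (Fin g ⊕ Fin g)) :=
    ⟨g + g, ⟨FreeGroup.freeGroupCongr finSumFinEquiv⟩⟩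
  obtain ⟨v, hv, hvp⟩ := exists_relatorValue (surfaceRelator g) hX fun θ =>
    map_surfaceRelator_eq_one g θ
  choose e he using fun i : Fin g ⊕ Fin g => exists_val₁_of_eq g (Pi.single i 1)
  obtain ⟨β, hβ⟩ := exists_val₁_of_eq g
    (Sum.elim (fun i => v (c (e (Sum.inr i)))) fun i => -v (c (e (Sum.inl i))))
  refine ⟨β, fun α => hv ?_⟩
  have hα : α = ∑ i, val₁ α (PresentedGroup.of i) • e i := val₁_ext_of fun j => by
    have h₁ : val₁ (∑ i, val₁ α (PresentedGroup.of i) • e i) (PresentedGroup.of j) =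
        ∑ i, val₁ α (PresentedGroup.of i) * val₁ (e i) (PresentedGroup.of j) := by
      refine (map_sum (AddMonoidHom.mk' (fun x => val₁ x (PresentedGroup.of j : SurfaceGroup g))
        fun x y => val₁_add x y _) _ _).trans (Finset.sum_congr rfl fun i _ => ?_)
      exact val₁_zsmul _ _ _
    rw [h₁]
    simp [he, Pi.single_apply]
  obtain ⟨f, hf⟩ := (intClass₂_eq_zero_iff
    (comapCocycle (PresentedGroup.mk {surfaceRelator g}) (cupCocycle α β))).1 (hX.H2_eq_zero _)
  have hmem : (cupCocycle α β, f) ∈ relatorPairs (surfaceRelator g) :=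
    (mem_relatorPairs_iff _ _).2 hf
  have h₁ : v (cup α β) = f (surfaceRelator g) - f 1 := hvp ⟨_, hmem⟩
  have h₂ : v (c α) = ∑ i, val₁ α (PresentedGroup.of i) * v (c (e i)) := by
    conv_lhs => rw [hα]
    simp
  rw [h₁, relator_value_cup g α β f hmem, h₂, Fintype.sum_sum_type, ← Finset.sum_add_distrib]
  refine Finset.sum_congr rfl fun i _ => ?_
  rw [hβ, hβ, Sum.elim_inl, Sum.elim_inr]
  ring

theorem IsHyperbolicSurfaceGroup.cupRepresents {B : Type} [Group B]
    (hB : IsHyperbolicSurfaceGroup B) : CupRepresents B := by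
  obtain ⟨g, -, ⟨e⟩⟩ := hB
  exact (cupRepresents_surfaceGroup g).of_mulEquiv e

end Duality

/-! ### Maximal isotropic subgroups -/

section MaximalIsotropic
variable {H Γ B : Type} [Group H] [Group Γ] [Group B] (S : GroupExtension H Γ B)

theorem exists_quotient_equiv_invH1 (hinj : Function.Injective (infl S 2)) :
    ∃ e : (H1 (trivZ Γ) ⧸ (infl S 1).range) ≃+ invH1 S,
      ∀ x : H1 (trivZ Γ), (e (QuotientAddGroup.mk x) : H1 (trivZ H)) = restr S 1 x := by
  let ρ : H1 (trivZ Γ) →+ invH1 S := (restr S 1).codRestrict (invH1 S) (restr_one_mem_invH1 S)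
  let l := QuotientAddGroup.lift (infl S 1).range ρ (by
    rintro _ ⟨x, rfl⟩
    exact Subtype.ext (restr_infl_one S x))
  refine ⟨AddEquiv.ofBijective l ⟨(injective_iff_map_eq_zero l).2 fun x => ?_, fun w => ?_⟩,
    fun x => rfl⟩
  · induction x using QuotientAddGroup.induction_on with
    | H x =>
      intro hx
      exact (QuotientAddGroup.eq_zero_iff x).2
        (mem_range_infl_one_of_restr_eq_zero S x (congrArg Subtype.val hx))
  · obtain ⟨x, hx⟩ := exists_restr_one_eq S hinj w w.2
    exact ⟨QuotientAddGroup.mk x, Subtype.ext hx⟩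

/-- If `w` is orthogonal to `H¹(B, ℤ)`, then an extension `x` of `w` to `Γ` has `p^*α ∪ x` inflated
from `B` for all `α`. By duality on `B`, `x` can be corrected by a class of `B` to make these
products vanish. -/
theorem exists_orthogonal_extension (hB : CupRepresents B) (hinj : Function.Injective (infl S 2))
    (w : invH1 S) (hw : ∀ α : H1 (trivZ B), cupInv (monodromyRep S) α w = 0) :
    ∃ x : H1 (trivZ Γ), restr S 1 x = w ∧ ∀ α, cup (infl S 1 α) x = 0 := by
  obtain ⟨x, hx⟩ := exists_restr_one_eq S hinj w w.2
  have hc : ∀ α, ∃ c, infl S 2 c = cup (infl S 1 α) x := fun α => by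
    obtain ⟨c, hc⟩ := mem_range_inflH2_of_edgeMap_eq_zero
      ⟨cup (infl S 1 α) x, cup_infl_mem_filtH2 S α x⟩
      ((edgeMap_cup α x _ w hx.symm).trans (hw α))
    exact ⟨c, congrArg Subtype.val hc⟩
  choose c hc using hc
  obtain ⟨β, hβ⟩ := hB (AddMonoidHom.mk' c fun α α' => hinj (by
    rw [map_add, hc, hc, hc, map_add, map_add, AddMonoidHom.add_apply]))
  refine ⟨x - infl S 1 β, by rw [map_sub, restr_infl_one, sub_zero, hx], fun α => ?_⟩
  have h : cup α β = c α := hβ α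
  rw [map_sub, cup_pullback, h, hc, sub_self]

theorem nondegenerateSecond_of_isMaximalIsotropic (hB : CupRepresents B)
    (hinj : Function.Injective (infl S 2)) (V : AddSubgroup (H1 (trivZ B)))
    (hV : IsMaximalIsotropic (V.map (infl S 1))) : NondegenerateSecond S := fun w hw => by
  obtain ⟨x, hxw, hx⟩ := exists_orthogonal_extension S hB hinj w hw
  have hx' : ∀ α, cup x (infl S 1 α) = 0 := fun α => by rw [cup_comm_neg, hx, neg_zero]
  have hiso : IsIsotropic (V.map (infl S 1) ⊔ AddSubgroup.zmultiples x) := by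
    intro a ha b hb
    obtain ⟨_, ⟨α, hα, rfl⟩, _, ⟨m, rfl⟩, rfl⟩ := AddSubgroup.mem_sup.1 ha
    obtain ⟨_, ⟨β, hβ, rfl⟩, _, ⟨n, rfl⟩, rfl⟩ := AddSubgroup.mem_sup.1 hb
    have h := hV.1 _ ⟨α, hα, rfl⟩ _ ⟨β, hβ, rfl⟩
    simp [h, hx, hx', cup_self, zsmul_zero]
  obtain ⟨α, -, hα⟩ : x ∈ V.map (infl S 1) := hV.2 hiso le_sup_left
    (AddSubgroup.mem_sup_right (AddSubgroup.mem_zmultiples x))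
  refine Subtype.ext ?_
  rw [← hxw, ← hα]
  exact restr_infl_one S α

theorem isMaximalIsotropic_of_nondegenerateSecond (hB : IsFreeOfFiniteRank B)
    (V : AddSubgroup (H1 (trivZ B))) (hV : IsMaximalIsotropic V) (hS : NondegenerateSecond S) :
    IsMaximalIsotropic (V.map (infl S 1)) := by
  have hVtop : V = ⊤ := top_le_iff.1 (hV.2 (fun _ _ _ _ => hB.H2_eq_zero _) le_top)
  subst hVtop
  refine ⟨?_, fun W hW hle x hx => ?_⟩
  · rintro _ ⟨α, -, rfl⟩ _ ⟨β, -, rfl⟩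
    exact (cup_pullback _ α β).trans ((congrArg _ (hB.H2_eq_zero _)).trans (map_zero _))
  · have h := hS ⟨restr S 1 x, restr_one_mem_invH1 S x⟩ fun α => by
      rw [← edgeMap_cup α x (cup_infl_mem_filtH2 S α x) _ rfl]
      have h₁ : cup (infl S 1 α) x = 0 := hW _ (hle ⟨α, trivial, rfl⟩) _ hx
      exact (congrArg _ (Subtype.ext h₁)).trans (map_zero (edgeMap S))
    obtain ⟨α, hα⟩ := mem_range_infl_one_of_restr_eq_zero S x (congrArg Subtype.val h)
    exact ⟨α, trivial, hα⟩

end MaximalIsotropic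

end

end GroupExtCup

theorem lemma7p2 {H Γ B : Type} [Group H] [Group Γ] [Group B] (S : GroupExtension H Γ B)
    (hB : IsFreeOfFiniteRank B ∨ IsHyperbolicSurfaceGroup B)
    (hinj : Function.Injective (infl S 2)) :
    -- `H¹(B, ℤ) ⊂ H¹(Γ, ℤ)` with quotient `H¹(H, ℤ)^B`, through inflation and restriction
    Function.Injective (infl S 1) ∧
    (∃ e : (H1 (trivZ Γ) ⧸ (infl S 1).range) ≃+ invH1 S,
      ∀ x : H1 (trivZ Γ), (e (QuotientAddGroup.mk x) : H1 (trivZ H)) = restr S 1 x) ∧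
    -- the cup product `H¹(B, ℤ) × H¹(Γ, ℤ) → H²(Γ, ℤ)` lands in `F`
    (∀ (α : H1 (trivZ B)) (x : H1 (trivZ Γ)), cup (infl S 1 α) x ∈ filtH2 S) ∧
    -- the exact sequence `0 → H²(B, ℤ) → F → H¹(B, H¹(H, ℤ)) → 0`
    (∃ (i : H2 (trivZ B) →+ filtH2 S) (π : filtH2 S →+ H1 (monodromyRep S)),
      (∀ c, (i c : H2 (trivZ Γ)) = infl S 2 c) ∧
      IsEdgeMap S π ∧
      Function.Injective i ∧ Function.Exact i π ∧ Function.Surjective π ∧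
      -- under `π`, the cup product on `Γ` becomes the one with values in `H¹(B, H¹(H, ℤ))`
      (∀ (α : H1 (trivZ B)) (x : H1 (trivZ Γ)) (hF : cup (infl S 1 α) x ∈ filtH2 S)
          (w : invH1 S), (w : H1 (trivZ H)) = restr S 1 x →
        π ⟨cup (infl S 1 α) x, hF⟩ = cupInv (monodromyRep S) α w)) ∧
    -- maximal isotropic subspaces: "only if" always, "if and only if" for `B` free
    (∀ V : AddSubgroup (H1 (trivZ B)), IsMaximalIsotropic V →
      (IsMaximalIsotropic (V.map (infl S 1)) → NondegenerateSecond S) ∧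
      (IsFreeOfFiniteRank B →
        (IsMaximalIsotropic (V.map (infl S 1)) ↔ NondegenerateSecond S))) := by
  have hsplit : SplitsCrossedModules B :=
    hB.elim IsFreeOfFiniteRank.splitsCrossedModules IsHyperbolicSurfaceGroup.splitsCrossedModules
  have hcup : CupRepresents B :=
    hB.elim IsFreeOfFiniteRank.cupRepresents IsHyperbolicSurfaceGroup.cupRepresents
  refine ⟨infl_one_injective S, exists_quotient_equiv_invH1 S hinj, cup_infl_mem_filtH2 S,
    ⟨inflH2 S, edgeMap S, coe_inflH2, isEdgeMap_edgeMap, fun c d h => hinj (congrArg Subtype.val h),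
      exact_inflH2_edgeMap, edgeMap_surjective S hsplit, edgeMap_cup⟩, fun V hV => ?_⟩
  have h := nondegenerateSecond_of_isMaximalIsotropic S hcup hinj V
  exact ⟨h, fun hfree => ⟨h, isMaximalIsotropic_of_nondegenerateSecond S hfree V hV⟩⟩
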